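/- For $n\ge 1$ let $A\subseteq\mathbb{F}_2^n$ be a random subset containing each element with probability $\tfrac12$, independently of the other elements, and let $\omega_n$ be the clique number (the size of the largest clique) of the random Cayley graph with vertex set $\mathbb{F}_2^n$ in which $x\neq y$ are joined if and only if $x+y\in A$. Let $\log$ denote the logarithm to base $2$. There exist strictly increasing sequences of positive integers $(n_i)_{i\ge 0}$ and $(m_j)_{j\ge 0}$ such that for every $\epsilon>0$ $$\lim_{i\to\infty}\mathbb{P}\left(\tfrac12 n_i\log n_i<\omega_{n_i}<\left(\tfrac12+\epsilon\right)n_i\log n_i\right)=1$$ and $$\lim_{j\to\infty}\mathbb{P}\left(m_j\log m_j<\omega_{m_j}<(1+\epsilon)\,m_j\log m_j\right)=1.$$ In this sense the constants $\tfrac12$ and $1+\epsilon$ are optimal in the theorem that $\lim_{n\to\infty}\mathbb{P}\left(\tfrac12 n\log n<\omega_n<(1+\epsilon)n\log n\right)=1$ for every $\epsilon>0$. -/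

import Mathlib

open MeasureTheory Filter Topology

/-- The elementary abelian group `𝔽₂ⁿ`, of order `2 ^ n`. -/
abbrev F2 (n : ℕ) : Type := Fin n → ZMod 2

/-- The Cayley sum graph on an abelian group `G` generated by `A ⊆ G`: the vertices are the elements
of `G`, and `x ≠ y` are joined if and only if `x + y ∈ A`. -/
def cayleySumGraph {G : Type*} [AddCommGroup G] (A : Set G) : SimpleGraph G where
  Adj x y := x ≠ y ∧ x + y ∈ A
  symm := ⟨fun x y h => ⟨h.1.symm, add_comm x y ▸ h.2⟩⟩
  loopless := ⟨fun _ h => h.1 rfl⟩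

/-- The law of the random generating set: each element of `𝔽₂ⁿ` belongs to it with probability
`1 / 2`, independently of the other elements. -/
noncomputable def randomSetLaw (n : ℕ) : Measure (Set (F2 n)) :=
  ProbabilityTheory.setBernoulli Set.univ ⟨1 / 2, by norm_num, by norm_num⟩

/-- The probability that `lo < ω < hi`, where `ω` is the clique number of the random Cayley graph
on `𝔽₂ⁿ`. -/
noncomputable def probCliqueNumBetween (n : ℕ) (lo hi : ℝ) : ℝ :=
  (randomSetLaw n).real
    {A | lo < ((cayleySumGraph A).cliqueNum : ℝ) ∧ ((cayleySumGraph A).cliqueNum : ℝ) < hi}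

/-- The function `n log n`, with logarithm to base `2`. -/
noncomputable def nlog (n : ℕ) : ℝ := (n : ℝ) * Real.logb 2 (n : ℝ)

/-! The clique number follows the powers of two. A subspace of dimension `d` whose nonzero elements
are all generators is a clique of size `2^d`, and by the second moment method such a subspace exists
once `2^d` is slightly below `d n`, which allows `2^d` to be slightly above `n log n`
(`eventually_randomSetLaw_real_cliqueNum_lt_le`). Conversely, once `2^(d+1)` exceeds `n log n` by a
constant factor, no clique is much larger than `2^d`
(`eventually_randomSetLaw_real_le_cliqueNum_le`). If `n log n` is just below `2^d`, the clique
number is therefore close to `n log n`; if it is slightly below `2^(d+1)`, the clique number is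
close to half of it.

For the upper bound, a clique yields a set `X` containing `0` such that `A` contains the nonzero
elements of `X + X`, an event of probability about `2^(-|X + X|)`. A union bound needs few
candidates for `X`. Fixing an embedding of the span, of rank `R`, costs a factor `2^(n R)`. If `X +
X` is large compared with `n R` and `|X|`, a container argument counts the candidates
(`card_filter_card_add_self_le`). Otherwise a Freiman-type inequality, proved by compressions
(`card_mul_le_card_add_self`), forces bounded doubling, so `X` is dense in its span and `R ≤ (1 +
o(1)) log n`. In this case only a subset of size `O(2^(R/2))` whose sumset still has almost
`2^(d+1)` elements is counted (`exists_small_subset_large_sumset`). It is found through triangle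
removal and the Kneser-type bound `two_pow_le_card_add`. The cost is then about `2^(n log n)`, which
`2^(-2^(d+1))` beats. -/

open scoped Pointwise

/-! ### Union bound, cliques as sumsets, second moment. -/

instance isProbabilityMeasure_randomSetLaw (n : ℕ) : IsProbabilityMeasure (randomSetLaw n) := by
  unfold randomSetLaw; infer_instance

/-- A Bernoulli random set of parameter `p` contains a given finite set `S` with probability
`p ^ |S|`. -/
lemma setBernoulli_univ_real_superset {ι : Type*} (p : unitInterval) (S : Finset ι) :
    (ProbabilityTheory.setBernoulli Set.univ p).real {A | (S : Set ι) ⊆ A} = (p : ℝ) ^ S.card := by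
  rw [measureReal_def, ProbabilityTheory.setBernoulli_apply']
  have : (fun p : ι → Prop => {i | p i}) ⁻¹' {A | (S : Set ι) ⊆ A}
      = Set.pi (S : Set ι) (fun _ => {True}) := by
    ext p
    simp [Set.subset_def, Set.mem_pi]
  rw [this, Measure.infinitePi_pi _ (by intros; exact MeasurableSet.of_discrete)]
  simp

/-- The random set contains a given finite set `S` with probability `2 ^ (-|S|)`. -/
lemma randomSetLaw_real_superset {n : ℕ} (S : Finset (F2 n)) :
    (randomSetLaw n).real {A | (S : Set (F2 n)) ⊆ A} = (1 / 2 : ℝ) ^ S.card :=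
  setBernoulli_univ_real_superset _ S

/-- Union bound over a finite family of finite sets. -/
lemma randomSetLaw_real_exists_superset_le {n : ℕ} {ι : Type*} (I : Finset ι)
    (S : ι → Finset (F2 n)) :
    (randomSetLaw n).real {A | ∃ i ∈ I, (S i : Set (F2 n)) ⊆ A}
      ≤ ∑ i ∈ I, (1 / 2 : ℝ) ^ (S i).card := by
  have : {A : Set (F2 n) | ∃ i ∈ I, (S i : Set (F2 n)) ⊆ A}
      = ⋃ i ∈ I, {A | (S i : Set (F2 n)) ⊆ A} := by
    ext A; simp
  rw [this]
  refine (measureReal_biUnion_finset_le _ _).trans ?_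
  simp [randomSetLaw_real_superset]

/-- A clique of given size can be translated so as to contain the origin, and then the nonzero
elements of its sumset belong to the generating set. -/
lemma exists_sumset_subset_of_le_cliqueNum {n k : ℕ} {A : Set (F2 n)} (hk : 0 < k)
    (h : k ≤ (cayleySumGraph A).cliqueNum) :
    ∃ X : Finset (F2 n), X.card = k ∧ 0 ∈ X ∧ (((X + X).erase 0 : Finset (F2 n)) : Set (F2 n)) ⊆ A := by
  obtain ⟨s, hs⟩ := (cayleySumGraph A).exists_isNClique_cliqueNum
  obtain ⟨t, hts, htk⟩ := Finset.exists_subset_card_eq (hs.card_eq.symm ▸ h)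
  obtain ⟨a, ha⟩ : t.Nonempty := Finset.card_pos.1 (htk ▸ hk)
  refine ⟨t.image (a + ·), ?_, ?_, ?_⟩
  · rw [Finset.card_image_of_injective _ (add_right_injective a), htk]
  · exact Finset.mem_image.2 ⟨a, ha, ZModModule.add_self a⟩
  · intro x hx
    obtain ⟨hx0, hx⟩ := Finset.mem_erase.1 hx
    obtain ⟨y, hy, z, hz, rfl⟩ := Finset.mem_add.1 hx
    obtain ⟨y, hy', rfl⟩ := Finset.mem_image.1 hy
    obtain ⟨z, hz', rfl⟩ := Finset.mem_image.1 hz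
    have e : a + y + (a + z) = y + z := by
      rw [add_add_add_comm, ZModModule.add_self, zero_add]
    rw [e] at hx0 ⊢
    have hyz : y ≠ z := by rintro rfl; exact hx0 (ZModModule.add_self y)
    exact (hs.isClique (hts hy') (hts hz') hyz).2

/-- A subspace whose nonzero elements are generators is a clique. -/
lemma card_le_cliqueNum_of_addClosed {n : ℕ} {A : Set (F2 n)} (V : Finset (F2 n))
    (hV : ∀ x ∈ V, ∀ y ∈ V, x + y ∈ V) (hA : ((V.erase 0 : Finset (F2 n)) : Set (F2 n)) ⊆ A) :
    V.card ≤ (cayleySumGraph A).cliqueNum := by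
  have hc : (cayleySumGraph A).IsClique (V : Set (F2 n)) := by
    intro x hx y hy hxy
    refine ⟨hxy, hA ?_⟩
    rw [Finset.mem_coe, Finset.mem_erase]
    exact ⟨fun h => hxy (by rwa [← ZModModule.sub_eq_add, sub_eq_zero] at h), hV x hx y hy⟩
  exact SimpleGraph.IsClique.card_le_cliqueNum (tc := hc)

/-- Second moment method for the events `S i ⊆ A`, where all the sets `S i` have the same size. -/
lemma randomSetLaw_real_forall_not_superset_le {n m : ℕ} {ι : Type*} [Fintype ι] [Nonempty ι]
    (S : ι → Finset (F2 n)) (hS : ∀ i, (S i).card = m) :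
    (randomSetLaw n).real {A | ∀ i, ¬ (S i : Set (F2 n)) ⊆ A}
      ≤ (∑ i, ∑ j, (2 : ℝ) ^ (S i ∩ S j).card) / (Fintype.card ι : ℝ) ^ 2 - 1 := by
  classical
  set P := randomSetLaw n
  have hmeas : ∀ B : Set (Set (F2 n)), MeasurableSet B := fun B => (Set.toFinite B).measurableSet
  set f : ι → Set (F2 n) → ℝ := fun i => Set.indicator {A | (S i : Set (F2 n)) ⊆ A} 1 with hf
  have hint : ∀ g : Set (F2 n) → ℝ, Integrable g P := fun g => Integrable.of_finite
  have hff : ∀ i j, ∫ A, f i A * f j A ∂P = (1 / 2 : ℝ) ^ (S i ∪ S j).card := by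
    intro i j
    rw [← randomSetLaw_real_superset, ← integral_indicator_one (hmeas _)]
    congr 1
    ext A
    simp only [hf, Set.indicator_apply, Set.mem_ofPred_eq, Finset.coe_union, Set.union_subset_iff,
      Pi.one_apply]
    split_ifs <;> simp_all
  have hfi : ∀ i, ∫ A, f i A ∂P = (1 / 2 : ℝ) ^ m := by
    intro i
    rw [← hS i, ← randomSetLaw_real_superset, ← integral_indicator_one (hmeas _)]
  set μ : ℝ := Fintype.card ι * (1 / 2 : ℝ) ^ m with hμ
  have hμ0 : 0 < μ := by positivity
  have h1 : ∫ A, (∑ i, f i A - μ) ^ 2 ∂P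
      = ((1 / 2 : ℝ) ^ m) ^ 2 * ∑ i, ∑ j, (2 : ℝ) ^ (S i ∩ S j).card - μ ^ 2 := by
    have e : ∀ A, (∑ i, f i A - μ) ^ 2
        = (∑ i, ∑ j, f i A * f j A) - 2 * μ * ∑ i, f i A + μ ^ 2 := by
      intro A
      rw [sub_sq, sq (∑ i, f i A), Finset.sum_mul_sum]
      ring
    simp_rw [e]
    rw [integral_add (hint _) (hint _), integral_sub (hint _) (hint _), integral_const_mul,
      integral_finsetSum _ (fun _ _ => hint _), integral_finsetSum _ (fun _ _ => hint _)]
    simp_rw [integral_finsetSum _ (fun _ _ => hint _), hff, hfi]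
    have e2 : ∀ i j, (1 / 2 : ℝ) ^ (S i ∪ S j).card
        = ((1 / 2 : ℝ) ^ m) ^ 2 * (2 : ℝ) ^ (S i ∩ S j).card := by
      intro i j
      have := Finset.card_union_add_card_inter (S i) (S j)
      rw [hS, hS] at this
      rw [← pow_mul, mul_two, ← this, pow_add, mul_assoc, ← mul_pow]
      norm_num
    simp_rw [e2, ← Finset.mul_sum]
    simp [hμ]
    ring
  -- Chebyshev: on the event that no `S i` is contained in `A`, the integrand equals `μ ^ 2`.
  have h2 : μ ^ 2 * P.real {A | ∀ i, ¬ (S i : Set (F2 n)) ⊆ A}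
      ≤ ∫ A, (∑ i, f i A - μ) ^ 2 ∂P := by
    rw [← integral_indicator_one (hmeas _), ← integral_const_mul]
    refine integral_mono (hint _) (hint _) fun A => ?_
    simp only [Set.indicator_apply, Set.mem_ofPred_eq, Pi.one_apply]
    split_ifs with h
    · have : ∑ i, f i A = 0 := Finset.sum_eq_zero fun i _ => by simp [hf, h i]
      rw [this]; simp
    · simp; positivity
  rw [h1] at h2
  rw [le_sub_iff_add_le, le_div_iff₀ (by positivity)]
  have h3 : ((1 / 2 : ℝ) ^ m) ^ 2 > 0 := by positivity
  rw [hμ] at h2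
  nlinarith

/-! ### Lower bound: random subspaces as graphs of linear maps. -/

/-- The number of linear maps vanishing on `j` given independent vectors. -/
lemma card_linearMap_vanishing {d m j : ℕ} (c : Fin j → F2 d) (hc : LinearIndependent (ZMod 2) c) :
    Nat.card {φ : F2 d →ₗ[ZMod 2] F2 m // ∀ i, φ (c i) = 0} = 2 ^ ((d - j) * m) := by
  let T : (F2 d →ₗ[ZMod 2] F2 m) →ₗ[ZMod 2] (Fin j → F2 m) :=
    { toFun := fun φ i => φ (c i), map_add' := fun _ _ => rfl, map_smul' := fun _ _ => rfl }
  have hT : Function.Surjective T := by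
    intro y
    obtain ⟨ψ, hψ⟩ := LinearMap.exists_extend
      ((Module.Basis.span hc).constr (ZMod 2) y)
    refine ⟨ψ, ?_⟩
    ext1 i
    have := LinearMap.congr_fun hψ (Module.Basis.span hc i)
    rw [Module.Basis.constr_basis] at this
    rw [← this]
    simp [T, Module.Basis.span_apply]
  have hr := T.finrank_range_add_finrank_ker
  rw [LinearMap.range_eq_top.2 hT, finrank_top, Module.finrank_linearMap] at hr
  simp only [Module.finrank_self, mul_one, Module.finrank_pi_fintype, Finset.sum_const, Finset.card_univ,
    Fintype.card_fin, smul_eq_mul] at hr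
  have e : {φ : F2 d →ₗ[ZMod 2] F2 m // ∀ i, φ (c i) = 0} ≃ LinearMap.ker T :=
    Equiv.subtypeEquivRight fun φ => by
      rw [LinearMap.mem_ker]
      exact ⟨fun h => funext h, fun h => congrFun h⟩
  rw [Nat.card_congr e, Module.natCard_eq_pow_finrank (K := ZMod 2), Nat.card_zmod, Nat.sub_mul, ← hr]
  congr 1
  omega

/-- The number of linear maps with kernel of dimension `j`. -/
lemma card_linearMap_finrank_ker_le [Fintype (F2 d →ₗ[ZMod 2] F2 m)] {j : ℕ} :
    (Finset.univ.filter fun φ : F2 d →ₗ[ZMod 2] F2 m =>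
      Module.finrank (ZMod 2) (LinearMap.ker φ) = j).card ≤ 2 ^ (d * j) * 2 ^ ((d - j) * m) := by
  classical
  have hsub : (Finset.univ.filter fun φ : F2 d →ₗ[ZMod 2] F2 m =>
      Module.finrank (ZMod 2) (LinearMap.ker φ) = j) ⊆
      (Finset.univ.filter fun c : Fin j → F2 d => LinearIndependent (ZMod 2) c).biUnion
        fun c => Finset.univ.filter fun φ : F2 d →ₗ[ZMod 2] F2 m => ∀ i, φ (c i) = 0 := by
    intro φ hφ
    rw [Finset.mem_filter] at hφ
    have b := Module.finBasisOfFinrankEq (ZMod 2) (LinearMap.ker φ) hφ.2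
    simp only [Finset.mem_biUnion, Finset.mem_filter, Finset.mem_univ, true_and]
    refine ⟨fun i => (b i : F2 d), ?_, fun i => LinearMap.mem_ker.1 (b i).2⟩
    exact b.linearIndependent.map' (LinearMap.ker φ).subtype (Submodule.ker_subtype _)
  refine (Finset.card_le_card hsub).trans (Finset.card_biUnion_le.trans ?_)
  have h1 : ∀ c ∈ (Finset.univ.filter fun c : Fin j → F2 d => LinearIndependent (ZMod 2) c),
      (Finset.univ.filter fun φ : F2 d →ₗ[ZMod 2] F2 m => ∀ i, φ (c i) = 0).card
        = 2 ^ ((d - j) * m) := by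
    intro c hc
    rw [← card_linearMap_vanishing c (Finset.mem_filter.1 hc).2, Nat.card_eq_fintype_card,
      Fintype.card_subtype]
  rw [Finset.sum_congr rfl h1, Finset.sum_const, smul_eq_mul]
  gcongr
  refine (Finset.card_filter_le _ _).trans ?_
  simp [Finset.card_univ, ZMod.card, ← pow_mul]

/-- A map with kernel of dimension `j` contributes less than `2^(2^j)`. Subtracting `1` cancels the
injective maps exactly, so the sum starts at `j = 1`. -/
lemma sum_two_pow_card_ker_le [Fintype (F2 d →ₗ[ZMod 2] F2 m)] :
    ∑ φ : F2 d →ₗ[ZMod 2] F2 m, ((2 : ℝ) ^ (Finset.univ.filter fun c => c ≠ 0 ∧ φ c = 0).card - 1)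
      ≤ ∑ j ∈ Finset.Icc 1 d, (2 : ℝ) ^ (2 ^ j) * (2 ^ (d * j) * 2 ^ ((d - j) * m)) := by
  classical
  have h1 : ∀ φ : F2 d →ₗ[ZMod 2] F2 m,
      ((2 : ℝ) ^ (Finset.univ.filter fun c => c ≠ 0 ∧ φ c = 0).card - 1) ≤
      ∑ j ∈ Finset.Icc 1 d, if Module.finrank (ZMod 2) (LinearMap.ker φ) = j
        then (2 : ℝ) ^ (2 ^ j) else 0 := by
    intro φ
    set r := Module.finrank (ZMod 2) (LinearMap.ker φ) with hr
    have hcard : (Finset.univ.filter fun c => φ c = 0).card = 2 ^ r := by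
      rw [hr, ← Fintype.card_subtype, ← Nat.card_eq_fintype_card]
      have := Module.natCard_eq_pow_finrank (K := ZMod 2) (V := LinearMap.ker φ)
      rw [Nat.card_zmod] at this
      exact this
    have hrd : r ≤ d := by
      have := Submodule.finrank_le (LinearMap.ker φ)
      simpa using this
    have hle : (Finset.univ.filter fun c => c ≠ 0 ∧ φ c = 0) ⊆
        (Finset.univ.filter fun c => φ c = 0).erase 0 := by
      intro c; simp
    have hle2 := Finset.card_le_card hle
    rw [Finset.card_erase_of_mem (by simp), hcard] at hle2
    rcases Nat.eq_zero_or_pos r with h0 | h0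
    · rw [h0] at hle2
      have : (Finset.univ.filter fun c => c ≠ 0 ∧ φ c = 0).card = 0 := by simpa using hle2
      rw [this]
      simp only [pow_zero, sub_self]
      exact Finset.sum_nonneg fun _ _ => by split_ifs <;> positivity
    · rw [Finset.sum_ite_eq, if_pos (Finset.mem_Icc.2 ⟨h0, hrd⟩)]
      have : (2 : ℝ) ^ (Finset.univ.filter fun c => c ≠ 0 ∧ φ c = 0).card ≤ 2 ^ 2 ^ r :=
        pow_le_pow_right₀ one_le_two (hle2.trans (Nat.sub_le _ _))
      linarith
  refine (Finset.sum_le_sum fun φ _ => h1 φ).trans ?_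
  rw [Finset.sum_comm]
  refine Finset.sum_le_sum fun j _ => ?_
  rw [← Finset.sum_filter, Finset.sum_const, nsmul_eq_mul, mul_comm]
  gcongr
  exact_mod_cast card_linearMap_finrank_ker_le

lemma Fin.append_add {d m : ℕ} (a a' : F2 d) (b b' : F2 m) :
    (Fin.append (a + a') (b + b') : F2 (d + m)) = Fin.append a b + Fin.append a' b' := by
  ext i
  refine Fin.addCases (fun i => ?_) (fun i => ?_) i <;> simp

lemma Fin.append_eq_zero_iff {d m : ℕ} (a : F2 d) (b : F2 m) :
    (Fin.append a b : F2 (d + m)) = 0 ↔ a = 0 ∧ b = 0 := by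
  constructor
  · intro h
    constructor
    · ext i; simpa using congrFun h (Fin.castAdd m i)
    · ext i; simpa using congrFun h (Fin.natAdd d i)
  · rintro ⟨rfl, rfl⟩
    ext i
    refine Fin.addCases (fun i => ?_) (fun i => ?_) i <;> simp

lemma Fin.append_inj_iff' {d m : ℕ} (a a' : F2 d) (b b' : F2 m) :
    (Fin.append a b : F2 (d + m)) = Fin.append a' b' ↔ a = a' ∧ b = b' := by
  have := Fin.append_eq_zero_iff (a + a') (b + b')
  rw [Fin.append_add, ← ZModModule.sub_eq_add, ← ZModModule.sub_eq_add, ← ZModModule.sub_eq_add,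
    sub_eq_zero, sub_eq_zero, sub_eq_zero] at this
  exact this

/-- Lower bound for the clique number by the second moment method. -/
lemma randomSetLaw_real_cliqueNum_lt_le_sum (d m : ℕ) :
    (randomSetLaw (d + m)).real {A | (cayleySumGraph A).cliqueNum < 2 ^ d}
      ≤ ∑ j ∈ Finset.Icc 1 d, (2 : ℝ) ^ (2 ^ j) * 2 ^ (d * j) / 2 ^ (j * m) := by
  classical
  have : Finite (F2 d →ₗ[ZMod 2] F2 m) := Module.finite_of_finite (ZMod 2)
  let : Fintype (F2 d →ₗ[ZMod 2] F2 m) := Fintype.ofFinite _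
  -- Restricting to graphs of linear maps gives `2^(d m)` subspaces of dimension `d`, and two graphs
  -- intersect in a copy of the kernel of the difference of the maps.
  let V : (F2 d →ₗ[ZMod 2] F2 m) → Finset (F2 (d + m)) := fun φ =>
    Finset.univ.image fun c : F2 d => Fin.append c (φ c)
  have hVcard : ∀ φ, (V φ).card = 2 ^ d := by
    intro φ
    rw [Finset.card_image_of_injective _ fun a b h => ((Fin.append_inj_iff' _ _ _ _).1 h).1]
    simp [ZMod.card]
  have hV0 : ∀ φ, 0 ∈ V φ := by
    intro φ
    exact Finset.mem_image.2 ⟨0, Finset.mem_univ _, by rw [Fin.append_eq_zero_iff]; simp⟩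
  have hle : (randomSetLaw (d + m)).real {A | (cayleySumGraph A).cliqueNum < 2 ^ d} ≤
      (randomSetLaw (d + m)).real
        {A | ∀ φ, ¬ (((V φ).erase 0 : Finset (F2 (d + m))) : Set (F2 (d + m))) ⊆ A} := by
    refine measureReal_mono fun A hA φ hφ => ?_
    have := card_le_cliqueNum_of_addClosed (V φ) ?_ hφ
    · rw [hVcard] at this
      exact absurd hA (not_lt.2 this)
    · intro x hx y hy
      obtain ⟨a, -, rfl⟩ := Finset.mem_image.1 hx
      obtain ⟨b, -, rfl⟩ := Finset.mem_image.1 hy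
      exact Finset.mem_image.2 ⟨a + b, Finset.mem_univ _, by rw [map_add, Fin.append_add]⟩
  refine hle.trans ((randomSetLaw_real_forall_not_superset_le (m := 2 ^ d - 1) _ fun φ => by
    rw [Finset.card_erase_of_mem (hV0 φ), hVcard]).trans ?_)
  have hinter : ∀ φ ψ, ((V φ).erase 0 ∩ (V ψ).erase 0).card =
      (Finset.univ.filter fun c => c ≠ 0 ∧ (φ - ψ) c = 0).card := by
    intro φ ψ
    rw [← Finset.card_image_of_injective (Finset.univ.filter fun c => c ≠ 0 ∧ (φ - ψ) c = 0)
      (f := fun c => (Fin.append c (φ c) : F2 (d + m)))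
      fun a b h => ((Fin.append_inj_iff' _ _ _ _).1 h).1]
    congr 1
    ext x
    simp only [Finset.mem_inter, Finset.mem_erase, V, Finset.mem_image, Finset.mem_filter,
      Finset.mem_univ, true_and, LinearMap.sub_apply, sub_eq_zero]
    constructor
    · rintro ⟨⟨hx, c, rfl⟩, -, c', hc'⟩
      obtain ⟨rfl, h⟩ := (Fin.append_inj_iff' _ _ _ _).1 hc'
      refine ⟨c', ⟨?_, h.symm⟩, rfl⟩
      rintro rfl
      exact hx (by rw [Fin.append_eq_zero_iff]; simp)
    · rintro ⟨c, ⟨hc, h⟩, rfl⟩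
      have : (Fin.append c (φ c) : F2 (d + m)) ≠ 0 := fun h' =>
        hc ((Fin.append_eq_zero_iff _ _).1 h').1
      exact ⟨⟨this, c, rfl⟩, this, c, by rw [h]⟩
  simp_rw [hinter]
  set g : (F2 d →ₗ[ZMod 2] F2 m) → ℝ := fun φ =>
    (2 : ℝ) ^ (Finset.univ.filter fun c => c ≠ 0 ∧ φ c = 0).card with hg
  -- Only the difference of the two maps matters, so the double sum collapses to a single one.
  have hsum : ∀ φ : F2 d →ₗ[ZMod 2] F2 m, ∑ ψ, (2 : ℝ) ^ (Finset.univ.filter fun c => c ≠ 0 ∧ (φ - ψ) c = 0).card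
      = ∑ ψ, g ψ := by
    intro φ
    exact Fintype.sum_equiv (Equiv.subLeft φ) _ _ fun ψ => rfl
  simp_rw [hsum]
  have hN : (Fintype.card (F2 d →ₗ[ZMod 2] F2 m) : ℝ) = 2 ^ (d * m) := by
    rw [← Nat.card_eq_fintype_card, Module.natCard_eq_pow_finrank (K := ZMod 2), Nat.card_zmod,
      Module.finrank_linearMap]
    simp
  rw [Finset.sum_const, Finset.card_univ, nsmul_eq_mul, hN]
  have hkey := sum_two_pow_card_ker_le (d := d) (m := m)
  rw [Finset.sum_sub_distrib, Finset.sum_const, Finset.card_univ, nsmul_eq_mul, hN] at hkey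
  have : (2 : ℝ) ^ (d * m) * ∑ ψ, g ψ / (2 ^ (d * m)) ^ 2 - 1
      = (∑ ψ, g ψ - 2 ^ (d * m) * 1) / 2 ^ (d * m) := by
    rw [← Finset.sum_div]
    field_simp
  rw [mul_div_assoc, Finset.sum_div, this, div_le_iff₀ (by positivity)]
  refine hkey.trans (le_of_eq ?_)
  rw [Finset.sum_mul]
  refine Finset.sum_congr rfl fun j hj => ?_
  have e : d * m = (d - j) * m + j * m := by
    rw [← add_mul, Nat.sub_add_cancel (Finset.mem_Icc.1 hj).2]
  rw [e, pow_add]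
  field_simp

/-- Monotonicity of `2^j / j`: the condition needed for every kernel dimension `j` follows from the
one for `d`. -/
lemma mul_two_pow_le_mul_two_pow {j d : ℕ} (hj : 1 ≤ j) (hjd : j ≤ d) : d * 2 ^ j ≤ j * 2 ^ d := by
  induction d, hjd using Nat.le_induction with
  | base => rfl
  | succ d hd ih =>
    have : (d + 1) * 2 ^ j ≤ 2 * (d * 2 ^ j) := by nlinarith [Nat.two_pow_pos j]
    rw [pow_succ]
    linarith

/-- If `2 ^ d` is a little smaller than `d * n`, then with high probability there is a clique of
size `2 ^ d`. -/
lemma randomSetLaw_real_cliqueNum_lt_le {n d q : ℕ} (hq : 1 ≤ q) (hdn : 2 * d + q ≤ n)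
    (h : 2 ^ d ≤ d * (n - 2 * d - q)) :
    (randomSetLaw n).real {A | (cayleySumGraph A).cliqueNum < 2 ^ d} ≤ 2 * (1 / 2 : ℝ) ^ q := by
  obtain ⟨m, rfl⟩ : ∃ m, n = d + m := ⟨n - d, by omega⟩
  refine (randomSetLaw_real_cliqueNum_lt_le_sum d m).trans ?_
  have h1 : ∀ j ∈ Finset.Icc 1 d, (2 : ℝ) ^ (2 ^ j) * 2 ^ (d * j) / 2 ^ (j * m)
      ≤ (1 / 2 : ℝ) ^ q * (1 / 2) ^ (j - 1) := by
    intro j hj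
    obtain ⟨hj1, hjd⟩ := Finset.mem_Icc.1 hj
    have h2 : 2 ^ j ≤ j * (d + m - 2 * d - q) := by
      have := mul_two_pow_le_mul_two_pow hj1 hjd
      have h3 : d * 2 ^ j ≤ d * (j * (d + m - 2 * d - q)) := by
        calc _ ≤ _ := this
          _ ≤ j * (d * (d + m - 2 * d - q)) := Nat.mul_le_mul_left _ h
          _ = _ := by ring
      exact Nat.le_of_mul_le_mul_left h3 (by omega)
    -- With this `t` the exponent `2^j + d j - j m` is at most `-j q`, because `2^j ≤ j t`; and `j q
    -- ≥ q + (j - 1)` since `q ≥ 1`.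
    obtain ⟨t, ht⟩ : ∃ t, m = d + q + t := ⟨m - d - q, by omega⟩
    have h4 : 2 ^ j ≤ j * t := by
      have : d + m - 2 * d - q = t := by omega
      rwa [this] at h2
    rw [div_le_iff₀ (by positivity), ← pow_add, ← pow_add]
    rw [one_div, inv_pow, ← div_eq_inv_mul, le_div_iff₀ (by positivity), ← pow_add]
    refine pow_le_pow_right₀ one_le_two ?_
    rw [ht]
    obtain ⟨i, rfl⟩ : ∃ i, j = i + 1 := ⟨j - 1, by omega⟩
    simp only [Nat.add_sub_cancel]
    nlinarith
  refine (Finset.sum_le_sum h1).trans ?_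
  rw [← Finset.mul_sum, mul_comm]
  gcongr
  have h5 : ∑ j ∈ Finset.Icc 1 d, (1 / 2 : ℝ) ^ (j - 1) = ∑ j ∈ Finset.range d, (1 / 2 : ℝ) ^ j := by
    rw [Finset.range_eq_Ico, Finset.sum_Ico_eq_sum_range, ← Finset.Ico_add_one_right_eq_Icc,
      Finset.sum_Ico_eq_sum_range]
    simp
  rw [h5, geom_sum_eq (by norm_num), div_le_iff_of_neg (by norm_num)]
  have : (0 : ℝ) ≤ (1 / 2) ^ d := by positivity
  linarith

/-! ### Compressions and a Freiman-type inequality. -/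

open scoped symmDiff FinsetFamily

section Compression

variable {β : Type*} [DecidableEq β]

/-- Replace every element `b` of `ℬ` by `φ b` unless `φ b` already belongs to `ℬ`. -/
def compressBy (φ : β → β) (ℬ : Finset β) : Finset β :=
  ℬ.image fun b => if φ b ∈ ℬ then b else φ b

lemma mem_compressBy {φ : β → β} {ℬ : Finset β} {x : β} :
    x ∈ compressBy φ ℬ ↔ (x ∈ ℬ ∧ φ x ∈ ℬ) ∨ (x ∉ ℬ ∧ ∃ b ∈ ℬ, φ b = x) := by
  unfold compressBy
  grind

/-- An element that stays remains in `ℬ` while one that moves lands outside `ℬ`, so only two moved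
elements could collide. Injectivity of `φ` is thus needed only at the points it moves. -/
lemma injOn_compressBy {φ : β → β} (hφ : ∀ b b', φ b ≠ b → φ b' ≠ b' → φ b = φ b' → b = b')
    (ℬ : Finset β) : Set.InjOn (fun b => if φ b ∈ ℬ then b else φ b) (ℬ : Set β) := by
  intro b hb b' hb' h
  have := hφ b b'
  simp only [Finset.mem_coe] at hb hb'
  by_cases h1 : φ b = b <;> by_cases h2 : φ b' = b' <;> grind

lemma card_compressBy {φ : β → β} (hφ : ∀ b b', φ b ≠ b → φ b' ≠ b' → φ b = φ b' → b = b')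
    (ℬ : Finset β) : (compressBy φ ℬ).card = ℬ.card :=
  Finset.card_image_of_injOn (injOn_compressBy hφ ℬ)

/-- A family minimizing a weight is fixed under all the compressions that reduce this weight. -/
lemma exists_compressed {ι : Type*} (Φ : ι → β → β) (w : β → ℕ)
    (hinj : ∀ i b b', Φ i b ≠ b → Φ i b' ≠ b' → Φ i b = Φ i b' → b = b')
    (hw : ∀ i b, Φ i b ≠ b → w (Φ i b) < w b) (P : Finset β → Prop)
    (hP : ∀ i ℬ, P ℬ → P (compressBy (Φ i) ℬ)) {ℬ₀ : Finset β} (h₀ : P ℬ₀) :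
    ∃ ℬ, P ℬ ∧ ∀ i, ∀ b ∈ ℬ, Φ i b ∈ ℬ := by
  obtain ⟨ℬ, hℬ, hmin⟩ := WellFounded.has_min (InvImage.wf (fun ℬ : Finset β => ∑ b ∈ ℬ, w b)
    Nat.lt_wfRel.wf) {ℬ | P ℬ} ⟨ℬ₀, h₀⟩
  refine ⟨ℬ, hℬ, fun i b hb => ?_⟩
  by_contra hcon
  refine hmin _ (hP i ℬ hℬ) ?_
  change ∑ b ∈ compressBy (Φ i) ℬ, w b < ∑ b ∈ ℬ, w b
  unfold compressBy
  rw [Finset.sum_image (injOn_compressBy (hinj i) ℬ)]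
  refine Finset.sum_lt_sum (fun c hc => ?_) ⟨b, hb, ?_⟩
  · have := hw i c
    grind
  · rw [if_neg hcon]
    exact hw i b fun h => hcon (by rwa [h])

end Compression

section SetFamily

variable {α : Type*} [DecidableEq α]

lemma mem_compressBy_erase {a : α} {ℬ : Finset (Finset α)} {x : Finset α} :
    x ∈ compressBy (fun y => y.erase a) ℬ ↔
      if a ∈ x then x ∈ ℬ ∧ x.erase a ∈ ℬ else x ∈ ℬ ∨ insert a x ∈ ℬ := by
  rw [mem_compressBy]
  split_ifs with h
  · grind
  · rw [Finset.erase_eq_of_notMem h]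
    constructor
    · rintro (h' | ⟨h1, b, hb, rfl⟩)
      · exact Or.inl h'.1
      · by_cases hab : a ∈ b
        · right; rwa [Finset.insert_erase hab]
        · rw [Finset.erase_eq_of_notMem hab] at h1; exact absurd hb h1
    · intro h'
      by_cases hx : x ∈ ℬ
      · exact Or.inl ⟨hx, hx⟩
      · exact Or.inr ⟨hx, _, h'.resolve_left hx, Finset.erase_insert h⟩

/-- Consequently erasing a coordinate does not increase the sumset. The decisive case has `a` in
exactly one of `x`, `y`: the one containing `a` lies in `ℬ` together with its erasure, so `x ∆ y`
and its erasure are both differences from `ℬ`. -/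
lemma image₂_symmDiff_compressBy_erase_subset (a : α) (ℬ : Finset (Finset α)) :
    Finset.image₂ (· ∆ ·) (compressBy (fun y => y.erase a) ℬ) (compressBy (fun y => y.erase a) ℬ) ⊆
      compressBy (fun y => y.erase a) (Finset.image₂ (· ∆ ·) ℬ ℬ) := by
  intro z hz
  obtain ⟨x, hx, y, hy, rfl⟩ := Finset.mem_image₂.1 hz
  rw [mem_compressBy_erase] at hx hy ⊢
  have key : ∀ x y : Finset α, a ∈ x → a ∉ y → x ∈ ℬ ∧ x.erase a ∈ ℬ → y ∈ ℬ ∨ insert a y ∈ ℬ →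
      x ∆ y ∈ Finset.image₂ (· ∆ ·) ℬ ℬ ∧ (x ∆ y).erase a ∈ Finset.image₂ (· ∆ ·) ℬ ℬ := by
    intro x y hax hay hx hy
    rcases hy with hy | hy
    · refine ⟨Finset.mem_image₂_of_mem hx.1 hy, Finset.mem_image₂.2 ⟨_, hx.2, _, hy, ?_⟩⟩
      ext b; simp only [Finset.mem_symmDiff, Finset.mem_erase]; by_cases hb : b = a <;> simp_all
    · refine ⟨Finset.mem_image₂.2 ⟨_, hx.2, _, hy, ?_⟩, Finset.mem_image₂.2 ⟨_, hx.1, _, hy, ?_⟩⟩ <;>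
      · ext b
        simp only [Finset.mem_symmDiff, Finset.mem_erase, Finset.mem_insert]
        by_cases hb : b = a <;> simp_all
  by_cases hax : a ∈ x <;> by_cases hay : a ∈ y <;>
    simp only [hax, hay, if_true, if_false, Finset.mem_symmDiff, not_true, not_false_iff, and_true,
      and_false, or_false, false_or] at hx hy ⊢
  · exact Or.inl (Finset.mem_image₂_of_mem hx.1 hy.1)
  · exact key x y hax hay hx hy
  · rw [symmDiff_comm]; exact key y x hay hax hy hx
  · rcases hx with hx | hx <;> rcases hy with hy | hy
    · exact Or.inl (Finset.mem_image₂_of_mem hx hy)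
    · right
      refine Finset.mem_image₂.2 ⟨_, hx, _, hy, ?_⟩
      ext b; simp only [Finset.mem_symmDiff, Finset.mem_insert]; by_cases hb : b = a <;> simp_all
    · right
      refine Finset.mem_image₂.2 ⟨_, hx, _, hy, ?_⟩
      ext b; simp only [Finset.mem_symmDiff, Finset.mem_insert]; by_cases hb : b = a <;> simp_all
    · left
      refine Finset.mem_image₂.2 ⟨_, hx, _, hy, ?_⟩
      ext b; simp only [Finset.mem_symmDiff, Finset.mem_insert]; by_cases hb : b = a <;> simp_all

/-- Replace `j` by `i`, if possible. -/
def shift (i j : α) (x : Finset α) : Finset α :=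
  if j ∈ x ∧ i ∉ x then insert i (x.erase j) else x

lemma mem_compressBy_shift {i j : α} (hij : i ≠ j) {ℬ : Finset (Finset α)} {x : Finset α} :
    x ∈ compressBy (shift i j) ℬ ↔
      if j ∈ x ∧ i ∉ x then x ∈ ℬ ∧ insert i (x.erase j) ∈ ℬ
      else if i ∈ x ∧ j ∉ x then x ∈ ℬ ∨ insert j (x.erase i) ∈ ℬ else x ∈ ℬ := by
  rw [mem_compressBy]
  have hi : ∀ b, shift i j b ≠ b → i ∈ shift i j b ∧ j ∉ shift i j b ∧
      insert j ((shift i j b).erase i) = b := by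
    intro b hb
    unfold shift at *
    split_ifs at * with h
    · refine ⟨by simp, by simp [hij.symm], ?_⟩
      rw [Finset.erase_insert (by simp [h.2]), Finset.insert_erase h.1]
    · simp at hb
  split_ifs with h1 h2
  · have e : shift i j x = insert i (x.erase j) := if_pos h1
    rw [e]
    refine ⟨fun h => h.resolve_right ?_, Or.inl⟩
    rintro ⟨hx, b, hb, rfl⟩
    exact (hi b fun h => hx (h.symm ▸ hb)).2.1 h1.1
  · have e : shift i j x = x := if_neg h1
    rw [e]
    constructor
    · rintro (h | ⟨hx, b, hb, rfl⟩)
      · exact Or.inl h.1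
      · right
        rw [(hi b fun h => hx (h.symm ▸ hb)).2.2]; exact hb
    · intro h
      by_cases hx : x ∈ ℬ
      · exact Or.inl ⟨hx, hx⟩
      · refine Or.inr ⟨hx, _, h.resolve_left hx, ?_⟩
        unfold shift
        rw [if_pos (by simp [hij]), Finset.erase_insert (by simp [h2.2]), Finset.insert_erase h2.1]
  · have e : shift i j x = x := if_neg h1
    rw [e]
    refine ⟨fun h => ?_, fun h => Or.inl ⟨h, h⟩⟩
    rcases h with h | ⟨hx, b, hb, rfl⟩
    · exact h.1
    · have := hi b fun h => hx (h.symm ▸ hb)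
      exact absurd ⟨this.1, this.2.1⟩ h2

/-- Some member of `ℬ` agrees with `x` off `{i, j}`, and a lower set contains the part of it there.
-/
lemma sdiff_pair_mem_of_mem_compressBy_shift {i j : α} (hij : i ≠ j) {ℬ : Finset (Finset α)}
    (hℬ : IsLowerSet (ℬ : Set (Finset α))) {x : Finset α} (hx : x ∈ compressBy (shift i j) ℬ) :
    x \ {i, j} ∈ ℬ := by
  rw [mem_compressBy_shift hij] at hx
  split_ifs at hx with h1 h2
  · exact hℬ (Finset.sdiff_subset) hx.1
  · rcases hx with hx | hx
    · exact hℬ (Finset.sdiff_subset) hx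
    · refine hℬ (fun b hb => ?_) hx
      simp only [Finset.mem_sdiff, Finset.mem_insert, Finset.mem_singleton, not_or] at hb
      simp [hb.1, hb.2.1]
  · exact hℬ (Finset.sdiff_subset) hx

lemma isLowerSet_compressBy_shift {i j : α} (hij : i ≠ j) {ℬ : Finset (Finset α)}
    (hℬ : IsLowerSet (ℬ : Set (Finset α))) :
    IsLowerSet (compressBy (shift i j) ℬ : Set (Finset α)) := by
  intro x y hyx hx
  have hyx' : y ⊆ x := hyx
  have hl : ∀ {u v : Finset α}, u ⊆ v → v ∈ ℬ → u ∈ ℬ := fun h hv => hℬ h hv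
  have hz := sdiff_pair_mem_of_mem_compressBy_shift hij hℬ hx
  rw [Finset.mem_coe, mem_compressBy_shift hij] at hx ⊢
  by_cases hyi : i ∈ y <;> by_cases hyj : j ∈ y
  · simp only [hyi, hyj, hyx' hyi, hyx' hyj, not_true, and_false, if_false] at hx ⊢
    exact hl hyx' hx
  · simp only [hyi, hyj, hyx' hyi, not_true, and_false, and_true, not_false_iff, if_false,
      if_true] at hx ⊢
    by_cases hxj : j ∈ x
    · simp only [hxj, not_true] at hx
      exact Or.inl (hl hyx' hx)
    · simp only [hxj, not_false_iff] at hx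
      refine hx.imp (hl hyx') (hl ?_)
      exact Finset.insert_subset_insert _ (Finset.erase_subset_erase _ hyx')
  · simp only [hyi, hyj, hyx' hyj, not_true, and_false, and_true, true_and, not_false_iff, if_false,
      if_true] at hx ⊢
    by_cases hxi : i ∈ x
    · simp only [hxi, not_true, if_false] at hx
      refine ⟨hl hyx' hx, hl ?_ hx⟩
      exact Finset.insert_subset hxi ((Finset.erase_subset _ _).trans hyx')
    · simp only [hxi, not_false_iff, if_true] at hx
      refine ⟨hl hyx' hx.1, hl ?_ hx.2⟩
      exact Finset.insert_subset_insert _ (Finset.erase_subset_erase _ hyx')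
  · simp only [hyi, hyj, false_and, if_false]
    refine hl (fun b hb => ?_) hz
    simp only [Finset.mem_sdiff, Finset.mem_insert, Finset.mem_singleton]
    exact ⟨hyx' hb, by rintro (rfl | rfl) <;> contradiction⟩

/-- In each of the sixteen cases for the positions of `i` and `j`, the required unions are formed
from members of `ℬ`. A factor whose elements in `{i, j}` are not needed is replaced by its part off
`{i, j}`; this is where the lower set property enters. -/
lemma sups_compressBy_shift_subset {i j : α} (hij : i ≠ j) {ℬ : Finset (Finset α)}
    (hℬ : IsLowerSet (ℬ : Set (Finset α))) :
    compressBy (shift i j) ℬ ⊻ compressBy (shift i j) ℬ ⊆ compressBy (shift i j) (ℬ ⊻ ℬ) := by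
  have hl : ∀ {u v : Finset α}, u ⊆ v → v ∈ ℬ → u ∈ ℬ := fun h hv => hℬ h hv
  have hmem : ∀ {u a b : Finset α}, a ∈ ℬ → b ∈ ℬ → (i ∈ a ∨ i ∈ b ↔ i ∈ u) →
      (j ∈ a ∨ j ∈ b ↔ j ∈ u) → (∀ c, c ≠ i → c ≠ j → (c ∈ a ∨ c ∈ b ↔ c ∈ u)) → u ∈ ℬ ⊻ ℬ := by
    intro u a b ha hb h1 h2 h3
    refine Finset.mem_sups.2 ⟨_, ha, _, hb, ?_⟩
    ext c
    rw [Finset.sup_eq_union, Finset.mem_union]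
    rcases eq_or_ne c i with rfl | hci
    · exact h1
    · rcases eq_or_ne c j with rfl | hcj
      · exact h2
      · exact h3 c hci hcj
  intro u hu
  obtain ⟨x, hx, y, hy, rfl⟩ := Finset.mem_sups.1 hu
  have hx0 := sdiff_pair_mem_of_mem_compressBy_shift hij hℬ hx
  have hy0 := sdiff_pair_mem_of_mem_compressBy_shift hij hℬ hy
  rw [mem_compressBy_shift hij] at hx hy ⊢
  rw [Finset.sup_eq_union]
  have hji := hij.symm
  by_cases hxi : i ∈ x <;> by_cases hxj : j ∈ x <;> by_cases hyi : i ∈ y <;> by_cases hyj : j ∈ y <;>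
    simp only [hxi, hxj, hyi, hyj, Finset.mem_union, or_true, or_false,
      not_true, not_false_iff, and_true, and_false, if_true, if_false]
      at hx hy ⊢
  all_goals first
    | exact hmem hx hy (by simp) (by simp) (by simp)
    | exact hmem hx hy0 (by simp [*]) (by simp [*]) (by simp +contextual)
    | exact hmem hx0 hy (by simp [*]) (by simp [*]) (by simp +contextual)
    | exact hx.elim (fun hx => hmem hx hy.1 (by simp [*]) (by simp [*]) (by simp +contextual)) (fun hx => hmem hx hy.2 (by simp [*]) (by simp [*]) (by simp +contextual))
    | exact hy.elim (fun hy => hmem hx.1 hy (by simp [*]) (by simp [*]) (by simp +contextual)) (fun hy => hmem hx.2 hy (by simp [*]) (by simp [*]) (by simp +contextual))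
    | exact hx.imp (fun hx => hmem hx hy0 (by simp [*]) (by simp [*]) (by simp +contextual)) (fun hx => hmem hx hy0 (by simp [*]) (by simp [*]) (by simp +contextual))
    | exact hy.imp (fun hy => hmem hx0 hy (by simp [*]) (by simp [*]) (by simp +contextual)) (fun hy => hmem hx0 hy (by simp [*]) (by simp [*]) (by simp +contextual))

/-- `x ∪ y = x ∆ (y \ x)` and `x ∆ y = (x \ y) ∪ (y \ x)`. For lower sets one may therefore work
with unions, for which shifting is well behaved. -/
lemma sups_eq_image₂_symmDiff {ℬ : Finset (Finset α)} (hℬ : IsLowerSet (ℬ : Set (Finset α))) :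
    ℬ ⊻ ℬ = Finset.image₂ (· ∆ ·) ℬ ℬ := by
  ext u
  simp only [Finset.mem_sups, Finset.mem_image₂, Finset.sup_eq_union]
  constructor
  · rintro ⟨x, hx, y, hy, rfl⟩
    refine ⟨x, hx, y \ x, hℬ Finset.sdiff_subset hy, ?_⟩
    ext c; simp only [Finset.mem_symmDiff, Finset.mem_sdiff, Finset.mem_union]; tauto
  · rintro ⟨x, hx, y, hy, rfl⟩
    refine ⟨x \ y, hℬ Finset.sdiff_subset hx, y \ x, hℬ Finset.sdiff_subset hy, ?_⟩
    ext c; simp only [Finset.mem_symmDiff, Finset.mem_sdiff, Finset.mem_union]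

/-- A family of minimal total size under erasures is closed under all of them, hence a lower set.
The singletons survive because `∅` stays in the family. -/
lemma exists_isLowerSet_card_image₂_symmDiff_le {𝒜 : Finset (Finset α)} (h0 : ∅ ∈ 𝒜)
    (h1 : ∀ i, {i} ∈ 𝒜) :
    ∃ ℬ : Finset (Finset α), ℬ.card = 𝒜.card ∧ IsLowerSet (ℬ : Set (Finset α)) ∧ (∀ i, {i} ∈ ℬ) ∧
      (ℬ ⊻ ℬ).card ≤ (Finset.image₂ (· ∆ ·) 𝒜 𝒜).card := by
  have hinj : ∀ (a : α) (b b' : Finset α), b.erase a ≠ b → b'.erase a ≠ b' →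
      b.erase a = b'.erase a → b = b' := by
    intro a b b' hb hb' h
    have ha : a ∈ b := by by_contra hc; exact hb (Finset.erase_eq_of_notMem hc)
    have ha' : a ∈ b' := by by_contra hc; exact hb' (Finset.erase_eq_of_notMem hc)
    rw [← Finset.insert_erase ha, h, Finset.insert_erase ha']
  obtain ⟨ℬ, ⟨hc, h0, h1, hs⟩, hfix⟩ := exists_compressed (fun (a : α) (y : Finset α) => y.erase a)
    Finset.card hinj
    (fun a b hb => Finset.card_erase_lt_of_mem (by
      by_contra hc; exact hb (Finset.erase_eq_of_notMem hc)))
    (fun ℬ => ℬ.card = 𝒜.card ∧ ∅ ∈ ℬ ∧ (∀ i, {i} ∈ ℬ) ∧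
      (Finset.image₂ (· ∆ ·) ℬ ℬ).card ≤ (Finset.image₂ (· ∆ ·) 𝒜 𝒜).card)
    (by
      rintro a ℬ ⟨hc, h0, h1, hs⟩
      refine ⟨(card_compressBy (hinj a) ℬ).trans hc, ?_, fun i => ?_, ?_⟩
      · rw [mem_compressBy_erase]; simp [h0]
      · rw [mem_compressBy_erase]
        split_ifs with h
        · rw [Finset.mem_singleton] at h
          subst h
          exact ⟨h1 a, by simpa using h0⟩
        · exact Or.inl (h1 i)
      · refine (Finset.card_le_card (image₂_symmDiff_compressBy_erase_subset a ℬ)).trans ?_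
        rwa [card_compressBy (hinj a)])
    ⟨rfl, h0, h1, le_rfl⟩
  have hlow : IsLowerSet (ℬ : Set (Finset α)) := by
    intro x y hyx hx
    have h : ∀ s : Finset α, x \ s ∈ ℬ := by
      intro s
      induction s using Finset.induction_on with
      | empty => simpa using hx
      | insert a s _ ih =>
        have := hfix a _ ih
        rwa [← Finset.sdiff_insert] at this
    have := h (x \ y)
    rwa [Finset.sdiff_sdiff_eq_self hyx] at this
  exact ⟨ℬ, hc, hlow, h1, by rwa [sups_eq_image₂_symmDiff hlow]⟩

/-- The weight of a set is the sum of its elements, which drops when `j` is replaced by a smaller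
`i`. -/
lemma exists_shifted_card_sups_le {R : ℕ} {𝒜 : Finset (Finset (Fin R))}
    (hl : IsLowerSet (𝒜 : Set (Finset (Fin R)))) (h1 : ∀ i, {i} ∈ 𝒜) :
    ∃ ℬ : Finset (Finset (Fin R)), ℬ.card = 𝒜.card ∧ IsLowerSet (ℬ : Set (Finset (Fin R))) ∧
      (∀ i, {i} ∈ ℬ) ∧ (ℬ ⊻ ℬ).card ≤ (𝒜 ⊻ 𝒜).card ∧
      ∀ i j, i < j → ∀ x ∈ ℬ, shift i j x ∈ ℬ := by
  have hinj : ∀ (p : {p : Fin R × Fin R // p.1 < p.2}) (b b' : Finset (Fin R)),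
      shift p.1.1 p.1.2 b ≠ b → shift p.1.1 p.1.2 b' ≠ b' →
      shift p.1.1 p.1.2 b = shift p.1.1 p.1.2 b' → b = b' := by
    rintro ⟨⟨i, j⟩, hij⟩ b b' hb hb' h
    simp only [shift] at hb hb' h
    split_ifs at hb hb' h with h1 h2
    · rw [← Finset.insert_erase h1.1, ← Finset.insert_erase h2.1]
      congr 1
      rw [← Finset.erase_insert (a := i) (s := b.erase j) (by simp [h1.2]), h,
        Finset.erase_insert (by simp [h2.2])]
    all_goals simp at hb hb'
  obtain ⟨ℬ, ⟨hc, hl, h1, hs⟩, hfix⟩ := exists_compressed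
    (fun (p : {p : Fin R × Fin R // p.1 < p.2}) => shift p.1.1 p.1.2) (fun x => ∑ i ∈ x, (i : ℕ)) hinj
    (by
      rintro ⟨⟨i, j⟩, hij⟩ b hb
      simp only [shift] at hb ⊢
      split_ifs at hb ⊢ with h1
      · rw [Finset.sum_insert (by simp [h1.2]), ← Finset.add_sum_erase b _ h1.1]
        exact Nat.add_lt_add_right hij _
      · simp at hb)
    (fun ℬ => ℬ.card = 𝒜.card ∧ IsLowerSet (ℬ : Set (Finset (Fin R))) ∧ (∀ i, {i} ∈ ℬ) ∧
      (ℬ ⊻ ℬ).card ≤ (𝒜 ⊻ 𝒜).card)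
    (by
      rintro p ℬ ⟨hc, hl, h1, hs⟩
      have hne : p.1.1 ≠ p.1.2 := p.2.ne
      refine ⟨(card_compressBy (hinj p) ℬ).trans hc, isLowerSet_compressBy_shift hne hl,
        fun i => ?_, ?_⟩
      · rw [mem_compressBy_shift hne]
        split_ifs with h h'
        · rw [Finset.mem_singleton] at h
          refine ⟨h1 i, ?_⟩
          rw [h.1, Finset.erase_singleton]
          exact h1 _
        · exact Or.inl (h1 i)
        · exact h1 i
      · refine (Finset.card_le_card (sups_compressBy_shift_subset hne hl)).trans ?_
        rwa [card_compressBy (hinj p)])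
    ⟨rfl, hl, h1, le_rfl⟩
  exact ⟨ℬ, hc, hl, h1, hs, fun i j hij => hfix ⟨(i, j), hij⟩⟩

lemma card_le_log_of_isLowerSet {α : Type*} {ℬ : Finset (Finset α)} (hl : IsLowerSet (ℬ : Set (Finset α)))
    {x : Finset α} (hx : x ∈ ℬ) : x.card ≤ Nat.log 2 ℬ.card := by
  have : x.powerset ⊆ ℬ := fun y hy => hl (Finset.mem_powerset.1 hy) hx
  have h2 := Finset.card_le_card this
  rw [Finset.card_powerset] at h2
  exact Nat.le_log_of_pow_le (by norm_num) h2

/-- Double counting of pairs `(x, p)` with `p` a two-element subset of `s \ x`. The union `x ∪ p`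
has at most `w + 2` elements, and together with `p` it determines `x`, so it arises from at most `(w
+ 2).choose 2` pairs. -/
lemma card_mul_choose_le_card_sups {ℬ : Finset (Finset α)} (hl : IsLowerSet (ℬ : Set (Finset α)))
    (s : Finset α) (hs : ∀ p ⊆ s, p.card = 2 → p ∈ ℬ) :
    ℬ.card * (s.card - Nat.log 2 ℬ.card).choose 2
      ≤ (Nat.log 2 ℬ.card + 2).choose 2 * (ℬ ⊻ ℬ).card := by
  set w := Nat.log 2 ℬ.card
  let Ω : Finset (Σ _ : Finset α, Finset α) := ℬ.sigma fun x => (s \ x).powersetCard 2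
  have h1 : ℬ.card * (s.card - w).choose 2 ≤ Ω.card := by
    rw [Finset.card_sigma, ← smul_eq_mul]
    refine Finset.card_nsmul_le_sum _ _ _ fun x hx => ?_
    rw [Finset.card_powersetCard]
    refine Nat.choose_le_choose _ ?_
    have := Finset.le_card_sdiff x s
    have := card_le_log_of_isLowerSet hl hx
    omega
  have h2 : Ω.card ≤ (w + 2).choose 2 * (Ω.image fun q => q.1 ∪ q.2).card := by
    refine Finset.card_le_mul_card_image _ _ fun z hz => ?_
    obtain ⟨⟨x, p⟩, hq, rfl⟩ := Finset.mem_image.1 hz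
    simp only [Ω, Finset.mem_sigma, Finset.mem_powersetCard] at hq
    have hzc : (x ∪ p).card ≤ w + 2 := by
      refine (Finset.card_union_le _ _).trans ?_
      have := card_le_log_of_isLowerSet hl hq.1
      omega
    refine le_trans ?_ (Nat.choose_le_choose 2 hzc)
    rw [← Finset.card_powersetCard]
    refine Finset.card_le_card_of_injOn (fun q => q.2) ?_ ?_
    · rintro ⟨y, r⟩ hr
      simp only [Ω, Finset.coe_filter, Finset.mem_sigma, Finset.mem_powersetCard,
        Set.mem_ofPred_eq] at hr
      simp only [Finset.mem_coe, Finset.mem_powersetCard]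
      exact ⟨hr.2 ▸ Finset.subset_union_right, hr.1.2.2⟩
    · rintro ⟨y, r⟩ hr ⟨y', r'⟩ hr' h
      simp only [Ω, Finset.coe_filter, Finset.mem_sigma, Finset.mem_powersetCard,
        Set.mem_ofPred_eq] at hr hr' h
      subst h
      have e : ∀ y, r ⊆ s \ y → y ∪ r = x ∪ p → y = (x ∪ p) \ r := by
        intro y h1 h2
        rw [← h2, Finset.union_sdiff_right, Finset.sdiff_eq_self_of_disjoint]
        exact (Finset.disjoint_of_subset_left h1 Finset.sdiff_disjoint).symm
      rw [e y hr.1.2.1 hr.2, e y' hr'.1.2.1 hr'.2]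
  refine (h1.trans h2).trans (Nat.mul_le_mul_left _ (Finset.card_le_card fun z hz => ?_))
  obtain ⟨⟨x, p⟩, hq, rfl⟩ := Finset.mem_image.1 hz
  simp only [Ω, Finset.mem_sigma, Finset.mem_powersetCard] at hq
  exact Finset.mem_sups.2 ⟨x, hq.1, p, hs p (hq.2.1.trans Finset.sdiff_subset) hq.2.2, rfl⟩

/-- For `x` disjoint from `T` and `i ∈ T`, both can be recovered from `x ∪ {i}`, as `i` is its only
element in `T`. -/
lemma card_filter_disjoint_mul_le_card_sups {ℬ : Finset (Finset α)} (h1 : ∀ i, {i} ∈ ℬ)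
    (T : Finset α) :
    (ℬ.filter fun x => Disjoint x T).card * T.card ≤ (ℬ ⊻ ℬ).card := by
  rw [← Finset.card_product]
  refine Finset.card_le_card_of_injOn (fun q => q.1 ∪ {q.2}) ?_ ?_
  · rintro ⟨x, i⟩ hq
    simp only [Finset.coe_product, Finset.coe_filter, Set.mem_prod, Set.mem_ofPred_eq] at hq
    exact Finset.mem_sups.2 ⟨x, hq.1.1, {i}, h1 i, rfl⟩
  · rintro ⟨x, i⟩ hq ⟨x', i'⟩ hq' h
    simp only [Finset.coe_product, Finset.coe_filter, Set.mem_prod, Set.mem_ofPred_eq,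
      Finset.mem_coe] at hq hq' h
    have hi : i ∈ x' ∪ {i'} := h ▸ by simp
    have hix : ∀ {x : Finset α} {i}, Disjoint x T → i ∈ T → i ∉ x := fun hd hi hx =>
      Finset.disjoint_left.1 hd hx hi
    have hii : i = i' := by
      have := hix hq'.1.2 hq.2
      simpa [this] using hi
    subst hii
    have e : ∀ {x : Finset α}, i ∉ x → (x ∪ {i}).erase i = x := by
      intro x hx
      rw [Finset.union_comm, ← Finset.insert_eq, Finset.erase_insert hx]
    rw [← e (hix hq.1.2 hq.2), h, e (hix hq'.1.2 hq.2)]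

/-- A lower bound for the size of `𝒜 ∆ 𝒜`, where `𝒜` contains the empty set and all singletons. -/
theorem card_mul_le_card_image₂_symmDiff {R : ℕ} {𝒜 : Finset (Finset (Fin R))} (h0 : ∅ ∈ 𝒜)
    (h1 : ∀ i, {i} ∈ 𝒜) :
    𝒜.card * (R / 2 - Nat.log 2 𝒜.card).choose 2
        ≤ (Nat.log 2 𝒜.card + 2).choose 2 * (Finset.image₂ (· ∆ ·) 𝒜 𝒜).card ∨
      𝒜.card * (R / 4) ≤ 2 * (Finset.image₂ (· ∆ ·) 𝒜 𝒜).card := by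
  obtain ⟨ℬ', hc', hl', h1', hs'⟩ := exists_isLowerSet_card_image₂_symmDiff_le h0 h1
  obtain ⟨ℬ, hc, hl, h1, hs, hfix⟩ := exists_shifted_card_sups_le hl' h1'
  rw [← hc', ← hc]
  replace hs := hs.trans hs'
  -- If a member has two elements in the upper half, shifting puts every pair from the lower half
  -- into `ℬ`. Otherwise each member meets the upper half in at most one point.
  by_cases h : ∃ x ∈ ℬ, ∃ j₁ ∈ x, ∃ j₂ ∈ x, j₁ < j₂ ∧ R / 2 ≤ (j₁ : ℕ)
  · left
    refine le_trans ?_ (Nat.mul_le_mul_left _ hs)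
    obtain ⟨x, hx, j₁, hj₁, j₂, hj₂, hlt, hR⟩ := h
    have hcard : (Finset.univ.filter fun i : Fin R => (i : ℕ) < R / 2).card = R / 2 := by
      rw [Fin.card_filter_val_lt]; omega
    have := card_mul_choose_le_card_sups hl (Finset.univ.filter fun i : Fin R => (i : ℕ) < R / 2) ?_
    · rwa [hcard] at this
    intro p hp hp2
    have hpair : ∀ i₁ i₂ : Fin R, i₁ < i₂ → (i₂ : ℕ) < R / 2 → {i₁, i₂} ∈ ℬ := by
      intro i₁ i₂ h12 h2
      have a0 : ({j₁, j₂} : Finset (Fin R)) ∈ ℬ := by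
        refine hl ?_ hx
        intro c hc
        rcases Finset.mem_insert.1 hc with rfl | hc
        · exact hj₁
        · rw [Finset.mem_singleton.1 hc]; exact hj₂
      have n1 : i₁ < j₁ := by rw [Fin.lt_def] at *; omega
      have n2 : i₂ < j₂ := by rw [Fin.lt_def] at *; omega
      have n3 : i₁ < j₂ := n1.trans hlt
      have n4 : i₂ < j₁ := by rw [Fin.lt_def] at *; omega
      have a1 := hfix i₁ j₁ n1 _ a0
      have e1 : shift i₁ j₁ {j₁, j₂} = {i₁, j₂} := by
        unfold shift
        rw [if_pos (by simp [n1.ne, n3.ne]), Finset.erase_insert (by simp [hlt.ne])]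
      rw [e1] at a1
      have a2 := hfix i₂ j₂ n2 _ a1
      have e2 : shift i₂ j₂ {i₁, j₂} = {i₁, i₂} := by
        unfold shift
        rw [if_pos (by simp [n2.ne, h12.ne'])]
        ext c
        simp only [Finset.mem_insert, Finset.mem_erase, Finset.mem_singleton]
        constructor
        · rintro (rfl | ⟨h, rfl | rfl⟩) <;> simp_all
        · rintro (rfl | rfl)
          · exact Or.inr ⟨n3.ne, Or.inl rfl⟩
          · exact Or.inl rfl
      rwa [e2] at a2
    obtain ⟨a, b, hab, rfl⟩ := Finset.card_eq_two.1 hp2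
    have ha := (Finset.mem_filter.1 (hp (Finset.mem_insert_self _ _))).2
    have hb := (Finset.mem_filter.1 (hp (Finset.mem_insert_of_mem (Finset.mem_singleton_self _)))).2
    rcases lt_or_gt_of_ne hab with hlt' | hlt'
    · exact hpair a b hlt' hb
    · rw [Finset.pair_comm]; exact hpair b a hlt' ha
  · right
    refine le_trans ?_ (Nat.mul_le_mul_left _ hs)
    push Not at h
    -- Two disjoint windows of length `R / 4` fit into the upper half and every member misses one of
    -- them, so one window is missed by at least half of `ℬ`.
    let T : ℕ → Finset (Fin R) := fun c =>
      Finset.univ.filter fun i : Fin R => c ≤ (i : ℕ) ∧ (i : ℕ) < c + R / 4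
    have hT : ∀ c, c + R / 4 ≤ R → (T c).card = R / 4 := by
      intro c hc
      have : (T c).card = (Finset.Ico c (c + R / 4)).card := by
        refine Finset.card_bij (fun i _ => (i : ℕ)) ?_ ?_ ?_
        · intro i hi
          exact Finset.mem_Ico.2 (Finset.mem_filter.1 hi).2
        · intro i _ j _ h; exact Fin.ext h
        · intro b hb
          rw [Finset.mem_Ico] at hb
          exact ⟨⟨b, by omega⟩, Finset.mem_filter.2 ⟨Finset.mem_univ _, hb⟩, rfl⟩
      rw [this, Nat.card_Ico]; omega
    have hcov : ℬ ⊆ (ℬ.filter fun x => Disjoint x (T (R / 2))) ∪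
        (ℬ.filter fun x => Disjoint x (T (R / 2 + R / 4))) := by
      intro x hx
      rw [Finset.mem_union, Finset.mem_filter, Finset.mem_filter]
      by_contra hcon
      push Not at hcon
      obtain ⟨a, hax, haT⟩ := Finset.not_disjoint_iff.1 (hcon.1 hx)
      obtain ⟨b, hbx, hbT⟩ := Finset.not_disjoint_iff.1 (hcon.2 hx)
      have ha := (Finset.mem_filter.1 haT).2
      have hb := (Finset.mem_filter.1 hbT).2
      have := h x hx a hax b hbx (by rw [Fin.lt_def]; omega)
      omega
    have hcard := (Finset.card_le_card hcov).trans (Finset.card_union_le _ _)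
    have e1 := card_filter_disjoint_mul_le_card_sups h1 (T (R / 2))
    have e2 := card_filter_disjoint_mul_le_card_sups h1 (T (R / 2 + R / 4))
    rw [hT _ (by omega)] at e1 e2
    calc _ ≤ _ := Nat.mul_le_mul_right _ hcard
      _ ≤ _ := by rw [add_mul]; omega

end SetFamily

/-- The Freiman-type inequality `card_mul_le_card_image₂_symmDiff` for subsets of `𝔽₂ᴿ`. -/
theorem card_mul_le_card_add_self {R : ℕ} {X : Finset (F2 R)} (h0 : 0 ∈ X)
    (h1 : ∀ i, Pi.single i 1 ∈ X) :
    X.card * (R / 2 - Nat.log 2 X.card).choose 2 ≤ (Nat.log 2 X.card + 2).choose 2 * (X + X).card ∨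
      X.card * (R / 4) ≤ 2 * (X + X).card := by
  let supp : F2 R → Finset (Fin R) := fun x => Finset.univ.filter fun i => x i ≠ 0
  have hz : ∀ a b : ZMod 2, a + b ≠ 0 ↔ (a ≠ 0 ∧ b = 0) ∨ (b ≠ 0 ∧ a = 0) := by decide
  have hinj : Function.Injective supp := by
    intro x y h
    ext i
    have := congrArg (i ∈ ·) h
    simp only [supp, Finset.mem_filter, Finset.mem_univ, true_and, eq_iff_iff] at this
    have hz2 : ∀ a b : ZMod 2, (a ≠ 0 ↔ b ≠ 0) → a = b := by decide
    rw [hz2 _ _ this]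
  have hadd : ∀ x y, supp (x + y) = supp x ∆ supp y := by
    intro x y
    ext i
    simp only [supp, Finset.mem_filter, Finset.mem_univ, true_and, Finset.mem_symmDiff, Pi.add_apply,
      hz, not_not]
  have hX : (X.image supp).card = X.card := Finset.card_image_of_injective _ hinj
  have hXX : (Finset.image₂ (· ∆ ·) (X.image supp) (X.image supp)).card = (X + X).card := by
    rw [← Finset.card_image_of_injective (X + X) hinj]
    congr 1
    rw [Finset.image₂_image_left, Finset.image₂_image_right]
    ext z
    simp only [Finset.mem_image₂, Finset.mem_image, Finset.mem_add, ← hadd]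
    constructor
    · rintro ⟨x, hx, y, hy, rfl⟩; exact ⟨_, ⟨x, hx, y, hy, rfl⟩, rfl⟩
    · rintro ⟨_, ⟨x, hx, y, hy, rfl⟩, rfl⟩; exact ⟨x, hx, y, hy, rfl⟩
  have := card_mul_le_card_image₂_symmDiff (𝒜 := X.image supp)
    (Finset.mem_image.2 ⟨0, h0, by simp [supp]⟩)
    (fun i => Finset.mem_image.2 ⟨_, h1 i, by
      ext j
      simp only [supp, Finset.mem_filter, Finset.mem_univ, true_and, Finset.mem_singleton,
        Pi.single_apply]
      split_ifs <;> simp_all⟩)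
  rwa [hX, hXX] at this

/-- A nonempty finite set with at most `m` elements is the range of a function on `Fin m`. -/
lemma exists_image_fin_eq {α : Type*} [DecidableEq α] {m : ℕ} {Y : Finset α} (hY : Y.Nonempty)
    (hm : Y.card ≤ m) : ∃ f : Fin m → α, Finset.univ.image f = Y := by
  obtain ⟨y₀, hy₀⟩ := hY
  let e := Y.equivFin
  refine ⟨fun i => if h : (i : ℕ) < Y.card then (e.symm ⟨i, h⟩ : α) else y₀, ?_⟩
  ext y
  simp only [Finset.mem_image, Finset.mem_univ, true_and]
  constructor
  · rintro ⟨i, rfl⟩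
    split_ifs with h
    · exact (e.symm ⟨i, h⟩).2
    · exact hy₀
  · intro hy
    exact ⟨⟨e ⟨y, hy⟩, (e ⟨y, hy⟩).2.trans_le hm⟩, by simp⟩

/-! ### Containers and the number of sets with given sumset size. -/

section Container

variable {V : Type*} [AddCommGroup V] [DecidableEq V]

/-- Every finite set contains a small subset `Y` such that most of each translate `x + Y` with
`x ∈ X` is contained in `Y + Y`. -/
lemma exists_subset_card_translate_sdiff_le {X : Finset V} {g : ℕ} (hg : 0 < g)
    (hX : 2 * g ≤ X.card) :
    ∃ Y ⊆ X, 2 * g ≤ Y.card ∧ Y.card ≤ 2 * g + (X + X).card / g ∧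
      ∀ x ∈ X, ((Y.image (x + ·)) \ (Y + Y)).card ≤ g := by
  classical
  -- The sets in `F` gain on average `g` sums for each element beyond the first `2 * g`. For a
  -- largest such `Y`, an `x ∈ X` with more than `g` new sums in `x + Y` could be added,
  -- contradicting maximality.
  let F : Finset (Finset V) := X.powerset.filter fun Y =>
    2 * g ≤ Y.card ∧ g * (Y.card - 2 * g) ≤ (Y + Y).card
  have hF : F.Nonempty := by
    obtain ⟨Y, hYX, hY⟩ := Finset.exists_subset_card_eq hX
    exact ⟨Y, by simp [F, hYX, hY]⟩
  obtain ⟨Y, hY, hmax⟩ := F.exists_max_image Finset.card hF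
  simp only [F, Finset.mem_filter, Finset.mem_powerset] at hY hmax
  refine ⟨Y, hY.1, hY.2.1, ?_, fun x hx => ?_⟩
  · have h1 : (Y + Y).card ≤ (X + X).card :=
      Finset.card_le_card (Finset.add_subset_add hY.1 hY.1)
    have h2 : Y.card - 2 * g ≤ (X + X).card / g := by
      rw [Nat.le_div_iff_mul_le hg, mul_comm]; exact hY.2.2.trans h1
    omega
  · by_contra hcon
    push Not at hcon
    have hxY : x ∉ Y := by
      intro hxY
      have : (Y.image (x + ·)) \ (Y + Y) = ∅ := by
        rw [Finset.sdiff_eq_empty_iff_subset]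
        intro z hz
        obtain ⟨y, hy, rfl⟩ := Finset.mem_image.1 hz
        exact Finset.add_mem_add hxY hy
      rw [this] at hcon
      simp at hcon
    have hcard : (insert x Y).card = Y.card + 1 := Finset.card_insert_of_notMem hxY
    have hsub : (Y + Y) ∪ ((Y.image (x + ·)) \ (Y + Y)) ⊆ insert x Y + insert x Y := by
      intro z hz
      rcases Finset.mem_union.1 hz with hz | hz
      · exact Finset.add_subset_add (Finset.subset_insert _ _) (Finset.subset_insert _ _) hz
      · obtain ⟨y, hy, rfl⟩ := Finset.mem_image.1 (Finset.mem_sdiff.1 hz).1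
        exact Finset.add_mem_add (Finset.mem_insert_self _ _) (Finset.mem_insert_of_mem hy)
    have h1 := Finset.card_le_card hsub
    rw [Finset.card_union_of_disjoint Finset.disjoint_sdiff] at h1
    have h2 := hmax (insert x Y) ⟨Finset.insert_subset hx hY.1, by omega, by
      rw [hcard]
      have : Y.card + 1 - 2 * g = (Y.card - 2 * g) + 1 := by omega
      rw [this, mul_add, mul_one]
      omega⟩
    omega

/-- The elements `c` such that most of `c + Y` is contained in `Y + Y`. -/
def container [Fintype V] (g : ℕ) (Y : Finset V) : Finset V :=
  Finset.univ.filter fun c => ((Y.image (c + ·)) \ (Y + Y)).card ≤ g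

/-- Double counting of pairs `(c, y)` with `c + y ∈ Y + Y`: as `g` is at most half of `|Y|`, each
`c` in the container has at least `|Y| / 2` partners, whereas each `y` has at most `|Y + Y|`. -/
lemma card_container_le [Fintype V] {g : ℕ} (hg : 0 < g) {Y : Finset V} (hY : 2 * g ≤ Y.card) :
    (container g Y).card ≤ 2 * (Y + Y).card := by
  have h1 : ∀ c ∈ container g Y, Y.card ≤ 2 * ((Y.image (c + ·)) ∩ (Y + Y)).card := by
    intro c hc
    have h2 := (Finset.mem_filter.1 hc).2
    have h3 := Finset.card_sdiff_add_card_inter (Y.image (c + ·)) (Y + Y)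
    rw [Finset.card_image_of_injective _ (add_right_injective c)] at h3
    omega
  have h4 : ∑ c ∈ container g Y, ((Y.image (c + ·)) ∩ (Y + Y)).card ≤ Y.card * (Y + Y).card := by
    calc ∑ c ∈ container g Y, ((Y.image (c + ·)) ∩ (Y + Y)).card
        ≤ ∑ c : V, (Y.filter fun y => c + y ∈ Y + Y).card := by
          refine (Finset.sum_le_sum_of_subset (Finset.subset_univ _)).trans
            (Finset.sum_le_sum fun c _ => ?_)
          rw [← Finset.card_image_of_injective (Y.filter _) (add_right_injective c)]
          refine Finset.card_le_card fun z hz => ?_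
          obtain ⟨hz1, hz2⟩ := Finset.mem_inter.1 hz
          obtain ⟨y, hy, rfl⟩ := Finset.mem_image.1 hz1
          exact Finset.mem_image.2 ⟨y, Finset.mem_filter.2 ⟨hy, hz2⟩, rfl⟩
      _ = ∑ y ∈ Y, (Finset.univ.filter fun c => c + y ∈ Y + Y).card := by
          simp_rw [Finset.card_filter]
          exact Finset.sum_comm
      _ ≤ ∑ y ∈ Y, (Y + Y).card := by
          refine Finset.sum_le_sum fun y _ => ?_
          refine Finset.card_le_card_of_injOn (· + y) (fun c hc => ?_) ?_
          · exact (Finset.mem_filter.1 hc).2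
          · exact fun a _ b _ h => add_right_cancel h
      _ = _ := by rw [Finset.sum_const, smul_eq_mul]
  have h5 : (container g Y).card * Y.card ≤ 2 * (Y.card * (Y + Y).card) := by
    refine le_trans ?_ (Nat.mul_le_mul_left 2 h4)
    rw [Finset.mul_sum, ← smul_eq_mul]
    exact Finset.card_nsmul_le_sum _ _ _ h1
  have h6 : (container g Y).card * Y.card ≤ 2 * (Y + Y).card * Y.card := by
    rw [mul_assoc, mul_comm (Y + Y).card]; exact h5
  exact Nat.le_of_mul_le_mul_right h6 (by omega)

/-- The number of sets of given size and given size of the sumset. -/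
lemma card_filter_card_add_self_le [Fintype V] {g k s : ℕ} (hg : 0 < g) (hk : 2 * g ≤ k) :
    (Finset.univ.filter fun X : Finset V => X.card = k ∧ (X + X).card = s).card
      ≤ Fintype.card V ^ (2 * g + s / g) * (2 * s).choose k := by
  classical
  set m := 2 * g + s / g
  let I : Finset (Fin m → V) := Finset.univ.filter fun f =>
    (container g (Finset.univ.image f)).card ≤ 2 * s
  have hsub : (Finset.univ.filter fun X : Finset V => X.card = k ∧ (X + X).card = s) ⊆
      I.biUnion fun f => (container g (Finset.univ.image f)).powersetCard k := by
    intro X hX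
    obtain ⟨-, hXk, hXs⟩ := Finset.mem_filter.1 hX
    obtain ⟨Y, hYX, hgY, hYm, hY⟩ :=
      exists_subset_card_translate_sdiff_le hg (hXk.symm ▸ hk : _ ≤ X.card)
    rw [hXs] at hYm
    have hYne : Y.Nonempty := Finset.card_pos.1 (by omega)
    obtain ⟨f, hf⟩ := exists_image_fin_eq hYne hYm
    refine Finset.mem_biUnion.2 ⟨f, Finset.mem_filter.2 ⟨Finset.mem_univ _, ?_⟩, ?_⟩
    · rw [hf]
      refine (card_container_le hg hgY).trans ?_
      rw [← hXs]
      exact Nat.mul_le_mul_left _ (Finset.card_le_card (Finset.add_subset_add hYX hYX))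
    · rw [hf, Finset.mem_powersetCard]
      exact ⟨fun x hx => Finset.mem_filter.2 ⟨Finset.mem_univ _, hY x hx⟩, hXk⟩
  refine (Finset.card_le_card hsub).trans (Finset.card_biUnion_le.trans ?_)
  refine (Finset.sum_le_card_nsmul I _ ((2 * s).choose k) fun f hf => ?_).trans ?_
  · rw [Finset.card_powersetCard]
    exact Nat.choose_le_choose _ (Finset.mem_filter.1 hf).2
  · rw [smul_eq_mul]
    gcongr
    refine (Finset.card_filter_le _ _).trans ?_
    simp [Finset.card_univ]

end Container

/-! ### Bounded doubling and a Kneser-type bound. -/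

/-- Ruzsa's argument. Plünnecke bounds `4 • X`, so the covering lemma gives `3 • X ⊆ F + (X + X)`
with `|F| ≤ K ^ 4`. With `W` the span of `F`, the set `W + (X + X)` is then stable under adding
elements of `X`, and so contains the span of `X`. -/
lemma two_pow_finrank_span_le {n K : ℕ} {X : Finset (F2 n)} (h0 : 0 ∈ X)
    (hK : (X + X).card ≤ K * X.card) :
    2 ^ Module.finrank (ZMod 2) (Submodule.span (ZMod 2) (X : Set (F2 n)))
      ≤ 2 ^ K ^ 4 * (K * X.card) := by
  classical
  have hXne : X.Nonempty := ⟨0, h0⟩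
  have hX0 : (0 : ℝ) < X.card := by exact_mod_cast Finset.card_pos.2 hXne
  have hpl := Finset.pluennecke_ruzsa_inequality_nsmul_add hXne X 4
  have hpl' : ((4 • X).card : ℝ) ≤ ((X + X).card / X.card : ℝ) ^ 4 * X.card := by
    have := (NNRat.cast_le (K := ℝ)).2 hpl
    push_cast at this
    exact this
  have h4 : ((3 • X + X).card : ℝ) ≤ (K : ℝ) ^ 4 * X.card := by
    rw [← succ_nsmul]
    refine hpl'.trans ?_
    gcongr
    rw [div_le_iff₀ hX0]
    exact_mod_cast hK
  obtain ⟨F, hF3, hFc, hcov⟩ := Finset.ruzsa_covering_add hXne h4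
  have hFc' : F.card ≤ K ^ 4 := by exact_mod_cast hFc
  have hXX : X - X = X + X := by
    ext z
    simp only [Finset.mem_sub, Finset.mem_add, ZModModule.sub_eq_add]
  rw [hXX] at hcov
  set W := Submodule.span (ZMod 2) (F : Set (F2 n))
  have hspan : ∀ v ∈ Submodule.span (ZMod 2) (X : Set (F2 n)), ∀ t : F2 n,
      (∃ w ∈ W, ∃ q ∈ X + X, w + q = t) → ∃ w ∈ W, ∃ q ∈ X + X, w + q = v + t := by
    intro v hv
    induction hv using Submodule.span_induction with
    | mem x hx =>
      rintro _ ⟨w, hw, q, hq, rfl⟩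
      have h3 : q + x ∈ 3 • X := by
        have : (3 • X) = X + X + X := by simp [succ_nsmul]
        rw [this]
        exact Finset.add_mem_add hq hx
      obtain ⟨f, hf, q', hq', hfq⟩ := Finset.mem_add.1 (hcov h3)
      refine ⟨w + f, W.add_mem hw (Submodule.subset_span hf), q', hq', ?_⟩
      rw [add_assoc, hfq]; abel
    | zero => intro t ht; simpa using ht
    | add x y _ _ hx hy =>
      intro t ht
      rw [add_assoc]
      exact hx _ (hy _ ht)
    | smul a x _ hx =>
      intro t ht
      have : a = 0 ∨ a = 1 := by revert a; decide
      rcases this with rfl | rfl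
      · simpa using ht
      · simpa using hx t ht
  have hsub : (Submodule.span (ZMod 2) (X : Set (F2 n)) : Set (F2 n)) ⊆
      (W : Set (F2 n)) + ((X + X : Finset (F2 n)) : Set (F2 n)) := by
    intro v hv
    obtain ⟨w, hw, q, hq, h⟩ := hspan v hv 0 ⟨0, W.zero_mem, 0, by
      simpa using Finset.add_mem_add h0 h0, by simp⟩
    exact Set.mem_add.2 ⟨w, hw, q, hq, by simpa using h⟩
  have hc1 := (Nat.card_mono (Set.toFinite _) hsub).trans (Set.natCard_add_le)
  have hcard : ∀ U : Submodule (ZMod 2) (F2 n),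
      Nat.card (U : Set (F2 n)) = 2 ^ Module.finrank (ZMod 2) U := by
    intro U
    have := Module.natCard_eq_pow_finrank (K := ZMod 2) (V := U)
    rw [Nat.card_zmod] at this
    exact this
  rw [hcard, hcard] at hc1
  refine hc1.trans ?_
  gcongr
  · norm_num
  · exact (finrank_span_finset_le_card F).trans hFc'
  · rw [Nat.card_coe_set_eq, Set.ncard_coe_finset]; exact hK

lemma exists_linearMap_apply_eq_one {R : ℕ} {u v : F2 R} (hu : u ≠ 0) (hv : v ≠ 0) :
    ∃ ξ : F2 R →ₗ[ZMod 2] ZMod 2, ξ u = 1 ∧ ξ v = 1 := by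
  have h01 : ∀ a : ZMod 2, a ≠ 0 → a = 1 := by decide
  have h01' : ∀ a : ZMod 2, a ≠ 1 → a = 0 := by decide
  obtain ⟨i, hi⟩ := Function.ne_iff.1 hu
  obtain ⟨j, hj⟩ := Function.ne_iff.1 hv
  have hi := h01 _ hi
  have hj := h01 _ hj
  by_cases h1 : u j = 1
  · exact ⟨LinearMap.proj j, h1, hj⟩
  by_cases h2 : v i = 1
  · exact ⟨LinearMap.proj i, hi, h2⟩
  refine ⟨(LinearMap.proj i : F2 R →ₗ[ZMod 2] ZMod 2) + LinearMap.proj j, ?_, ?_⟩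
  · simp [hi, h01' _ h1]
  · simp [hj, h01' _ h2]

/-- If `|A| + |B| > 2 ^ d` for nonempty subsets of an elementary abelian `2`-group, then
`|A + B| ≥ 2 ^ d`. -/
lemma two_pow_le_card_add {R : ℕ} (d : ℕ) : ∀ {A B : Finset (F2 R)}, A.Nonempty → B.Nonempty →
    2 ^ d < A.card + B.card → 2 ^ d ≤ (A + B).card := by
  induction d with
  | zero => intro A B hA hB _; exact Finset.card_pos.2 (hA.add hB)
  | succ d ih =>
    intro A B hA hB h
    by_cases hA1 : A.card ≤ 1
    · have := Finset.card_le_card_add_left (t := B) hA; omega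
    by_cases hB1 : B.card ≤ 1
    · have := Finset.card_le_card_add_right (s := A) hB; omega
    push Not at hA1 hB1
    obtain ⟨a, ha, a', ha', haa⟩ := Finset.one_lt_card.1 hA1
    obtain ⟨b, hb, b', hb', hbb⟩ := Finset.one_lt_card.1 hB1
    -- A functional that is nonconstant on both sets makes all four slices nonempty, as the
    -- induction hypothesis requires.
    obtain ⟨ξ, hξa, hξb⟩ := exists_linearMap_apply_eq_one (sub_ne_zero.2 haa) (sub_ne_zero.2 hbb)
    rw [map_sub] at hξa hξb
    have h2 : ∀ x y : ZMod 2, x - y = 1 → ∀ z, x = z ∨ y = z := by decide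
    have hne : ∀ (C : Finset (F2 R)) (c c' : F2 R), c ∈ C → c' ∈ C → ξ c - ξ c' = 1 →
        ∀ z, (C.filter fun x => ξ x = z).Nonempty := by
      intro C c c' hc hc' h z
      rcases h2 _ _ h z with h | h
      · exact ⟨c, Finset.mem_filter.2 ⟨hc, h⟩⟩
      · exact ⟨c', Finset.mem_filter.2 ⟨hc', h⟩⟩
    have hsplit : ∀ C : Finset (F2 R),
        (C.filter fun x => ξ x = 0).card + (C.filter fun x => ξ x = 1).card = C.card := by
      intro C
      rw [← Finset.card_filter_add_card_filter_not (s := C) (fun x => ξ x = 0)]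
      congr 2
      ext x
      have : ∀ z : ZMod 2, z = 1 ↔ ¬ z = 0 := by decide
      simp [this]
    have hsub : ∀ z w, (A.filter fun x => ξ x = z) + (B.filter fun x => ξ x = w) ⊆
        (A + B).filter fun x => ξ x = z + w := by
      intro z w x hx
      obtain ⟨p, hp, q, hq, rfl⟩ := Finset.mem_add.1 hx
      rw [Finset.mem_filter] at hp hq ⊢
      exact ⟨Finset.add_mem_add hp.1 hq.1, by rw [map_add, hp.2, hq.2]⟩
    have key : ∀ z w, 2 ^ d < (A.filter fun x => ξ x = z).card + (B.filter fun x => ξ x = w).card →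
        2 ^ d ≤ ((A + B).filter fun x => ξ x = z + w).card := fun z w hzw =>
      (ih (hne A a a' ha ha' hξa z) (hne B b b' hb hb' hξb w) hzw).trans
        (Finset.card_le_card (hsub z w))
    have hA' := hsplit A
    have hB' := hsplit B
    have hAB := hsplit (A + B)
    have k00 := key 0 0
    have k11 := key 1 1
    have k01 := key 0 1
    have k10 := key 1 0
    have e11 : (1 + 1 : ZMod 2) = 0 := by decide
    simp only [e11, add_zero, zero_add] at k00 k11 k01 k10
    rw [pow_succ] at h ⊢
    -- Over the value `0` lie the sums of equally labelled slices. The two pairs have `|A| + |B| > 2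
    -- * 2 ^ d` elements in total, so one pair exceeds `2 ^ d`.
    have s0 : 2 ^ d ≤ ((A + B).filter fun x => ξ x = 0).card := by
      by_cases hc : 2 ^ d < (A.filter fun x => ξ x = 0).card + (B.filter fun x => ξ x = 0).card
      · exact k00 hc
      · exact k11 (by omega)
    have s1 : 2 ^ d ≤ ((A + B).filter fun x => ξ x = 1).card := by
      by_cases hc : 2 ^ d < (A.filter fun x => ξ x = 0).card + (B.filter fun x => ξ x = 1).card
      · exact k01 hc
      · exact k10 (by omega)
    omega

/-! ### Triangle removal and popular sums. -/

section Removal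

variable {R : ℕ}

/-- The number of representations of `s` as the sum of two elements of `X`. -/
def repr2 (X : Finset (F2 R)) (s : F2 R) : ℕ := (X.filter fun x => s + x ∈ X).card

/-- The tripartite graph whose triangles correspond to solutions of `x + x' = q` with `x, x' ∈ X`
and `q ∈ Q`. -/
def sumTripartite (X Q : Finset (F2 R)) : SimpleGraph (Fin 3 × F2 R) where
  Adj p q := p.1 ≠ q.1 ∧ p.2 + q.2 ∈ if p.1 = 1 ∨ q.1 = 1 then X else Q
  symm := ⟨fun p q h => ⟨h.1.symm, by
    simp only [add_comm q.2, or_comm (a := q.1 = 1)]; exact h.2⟩⟩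
  loopless := ⟨fun _ h => h.1 rfl⟩

instance (X Q : Finset (F2 R)) : DecidableRel (sumTripartite X Q).Adj := fun p q => by
  unfold sumTripartite; infer_instance

/-- A triangle `(0, a), (1, b), (2, c)` satisfies `(a + b) + (b + c) = a + c`, so it is given by the
base point `a` and a representation of `a + c ∈ Q`. -/
lemma card_cliqueFinset_sumTripartite_le (X Q : Finset (F2 R)) :
    ((sumTripartite X Q).cliqueFinset 3).card ≤ 2 ^ R * ∑ q ∈ Q, repr2 X q := by
  let Ω : Finset (F2 R × Σ _ : F2 R, F2 R) :=
    Finset.univ ×ˢ Q.sigma fun q => X.filter fun x => q + x ∈ X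
  have hΩ : Ω.card = 2 ^ R * ∑ q ∈ Q, repr2 X q := by
    simp [Ω, Finset.card_product, Finset.card_sigma, repr2, Finset.card_univ, ZMod.card]
  rw [← hΩ]
  refine (Finset.card_le_card fun t ht => ?_).trans (Finset.card_image_le (s := Ω)
    (f := fun p => {((0 : Fin 3), p.1), (1, p.1 + p.2.2), (2, p.1 + p.2.1)}))
  rw [SimpleGraph.mem_cliqueFinset_iff] at ht
  have hinj : Set.InjOn Prod.fst (t : Set (Fin 3 × F2 R)) := by
    intro p hp q hq h
    by_contra hpq
    exact (ht.isClique hp hq hpq).1 h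
  have himg : t.image Prod.fst = Finset.univ := by
    rw [← Finset.card_eq_iff_eq_univ, Finset.card_image_of_injOn hinj, ht.card_eq, Fintype.card_fin]
  have hex : ∀ i : Fin 3, ∃ a, (i, a) ∈ t := by
    intro i
    obtain ⟨⟨j, a⟩, h, rfl⟩ := Finset.mem_image.1 (himg ▸ Finset.mem_univ i)
    exact ⟨a, h⟩
  obtain ⟨a, ha⟩ := hex 0
  obtain ⟨b, hb⟩ := hex 1
  obtain ⟨c, hc⟩ := hex 2
  have hab := (ht.isClique ha hb (by simp)).2
  have hbc := (ht.isClique hb hc (by simp)).2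
  have hac := (ht.isClique ha hc (by simp)).2
  simp only [true_or, or_true, if_true] at hab hbc
  have : ¬ ((0 : Fin 3) = 1 ∨ (2 : Fin 3) = 1) := by decide
  simp only [this, if_false] at hac
  have hself : ∀ x y : F2 R, x + (x + y) = y := fun x y => by
    rw [← add_assoc, ZModModule.add_self, zero_add]
  refine Finset.mem_image.2 ⟨(a, ⟨a + c, a + b⟩), ?_, ?_⟩
  · simp only [Ω, Finset.mem_product, Finset.mem_univ, true_and, Finset.mem_sigma,
      Finset.mem_filter]
    refine ⟨hac, hab, ?_⟩
    rwa [add_add_add_comm, ZModModule.add_self, zero_add, add_comm]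
  · simp only [hself]
    refine Finset.eq_of_subset_of_card_le ?_ ?_
    · intro p hp
      simp only [Finset.mem_insert, Finset.mem_singleton] at hp
      rcases hp with rfl | rfl | rfl <;> assumption
    · rw [ht.card_eq, Finset.card_eq_three.2 ⟨_, _, _, _, _, _, rfl⟩] <;> simp

/-- If few pairs of elements of `X` have their sum in `Q`, then after the removal of few elements
from `X` and `Q` no such pairs are left. -/
lemma exists_sum_free_of_sum_repr2_lt {ε : ℝ} {X Q : Finset (F2 R)}
    (h : (2 ^ R * ∑ q ∈ Q, repr2 X q : ℕ)
      < SimpleGraph.triangleRemovalBound ε * (3 * 2 ^ R : ℕ) ^ 3) :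
    ∃ X' ⊆ X, ∃ Q' ⊆ Q, ((X \ X').card : ℝ) ≤ 54 * ε * 2 ^ R ∧ ((Q \ Q').card : ℝ) ≤ 27 * ε * 2 ^ R ∧
      ∀ x ∈ X', ∀ y ∈ X', x + y ∉ Q' := by
  classical
  have hcardV : Fintype.card (Fin 3 × F2 R) = 3 * 2 ^ R := by simp [ZMod.card]
  obtain ⟨G', hG', hdec, hedge, hfree⟩ := SimpleGraph.triangle_removal (G := sumTripartite X Q)
    (ε := ε) (by
      rw [hcardV]
      refine lt_of_le_of_lt ?_ h
      exact_mod_cast card_cliqueFinset_sumTripartite_le X Q)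
  rw [hcardV] at hedge
  set D := (sumTripartite X Q).edgeFinset \ G'.edgeFinset
  have hD : (D.card : ℝ) < 9 * ε * (2 ^ R) ^ 2 := by
    have hle : G'.edgeFinset ⊆ (sumTripartite X Q).edgeFinset := SimpleGraph.edgeFinset_mono hG'
    have : D.card + G'.edgeFinset.card = (sumTripartite X Q).edgeFinset.card :=
      Finset.card_sdiff_add_card_eq_card hle
    have h2 : ((sumTripartite X Q).edgeFinset.card : ℝ) = D.card + G'.edgeFinset.card := by
      exact_mod_cast this.symm
    rw [h2] at hedge
    push_cast at hedge
    linarith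
  -- number of deleted edges between two classes which correspond to a given sum
  let B : Fin 3 → Fin 3 → F2 R → Finset (F2 R) := fun i j t =>
    Finset.univ.filter fun a => ¬ G'.Adj (i, a) (j, a + t)
  have hself : ∀ x y : F2 R, x + (x + y) = y := fun x y => by
    rw [← add_assoc, ZModModule.add_self, zero_add]
  have hB : ∀ i j : Fin 3, i ≠ j → ∀ T : Finset (F2 R), (T ⊆ if i = 1 ∨ j = 1 then X else Q) →
      ((T.filter fun t => 2 ^ R ≤ 3 * (B i j t).card).card : ℝ) ≤ 27 * ε * 2 ^ R := by
    intro i j hij T hT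
    have h1 : ((T.filter fun t => 2 ^ R ≤ 3 * (B i j t).card).sigma fun t => B i j t).card
        ≤ D.card := by
      refine Finset.card_le_card_of_injOn (fun p => s((i, p.2), (j, p.2 + p.1))) ?_ ?_
      · rintro ⟨t, a⟩ hp
        simp only [Finset.coe_sigma, Set.mem_sigma_iff, Finset.mem_coe, Finset.mem_filter,
          B, Finset.mem_univ, true_and] at hp
        simp only [D, Finset.coe_sdiff, Set.mem_sdiff, Finset.mem_coe, SimpleGraph.mem_edgeFinset,
          SimpleGraph.mem_edgeSet]
        refine ⟨⟨hij, ?_⟩, hp.2⟩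
        simp only [hself]
        exact hT hp.1.1
      · rintro ⟨t, a⟩ - ⟨t', a'⟩ - h
        simp only [Sym2.eq_iff, Prod.mk.injEq] at h
        rcases h with ⟨⟨-, rfl⟩, -, h⟩ | ⟨⟨h, -⟩, -⟩
        · rw [add_left_cancel h]
        · exact absurd h hij
    rw [Finset.card_sigma] at h1
    set T' := T.filter fun t => 2 ^ R ≤ 3 * (B i j t).card
    have h2 : T'.card * 2 ^ R ≤ 3 * D.card := by
      refine le_trans ?_ (Nat.mul_le_mul_left 3 h1)
      rw [Finset.mul_sum, ← smul_eq_mul]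
      exact Finset.card_nsmul_le_sum _ _ _ fun t ht => (Finset.mem_filter.1 ht).2
    have h3 : (T'.card : ℝ) * 2 ^ R ≤ 3 * D.card := by exact_mod_cast h2
    have h4 : (0 : ℝ) < 2 ^ R := by positivity
    have h5 : (T'.card : ℝ) * 2 ^ R ≤ 27 * ε * 2 ^ R * 2 ^ R := by nlinarith
    exact le_of_mul_le_mul_right h5 h4
  -- An element is discarded when at least a third of its `2 ^ R` edges between two classes are
  -- missing. Fewer than `9 * ε * (2 ^ R) ^ 2` edges were deleted, so each pair of classes discards
  -- at most `27 * ε * 2 ^ R`; `X` serves two pairs and `Q` one.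
  refine ⟨(X.filter fun t => ¬ 2 ^ R ≤ 3 * (B 0 1 t).card).filter
      fun t => ¬ 2 ^ R ≤ 3 * (B 1 2 t).card,
    (Finset.filter_subset _ _).trans (Finset.filter_subset _ _),
    Q.filter fun t => ¬ 2 ^ R ≤ 3 * (B 0 2 t).card, Finset.filter_subset _ _, ?_, ?_, ?_⟩
  · have h1 := hB 0 1 (by decide) X (by simp)
    have h2 := hB 1 2 (by decide) X (by simp)
    have : (X \ ((X.filter fun t => ¬ 2 ^ R ≤ 3 * (B 0 1 t).card).filter
      fun t => ¬ 2 ^ R ≤ 3 * (B 1 2 t).card)) ⊆ (X.filter fun t => 2 ^ R ≤ 3 * (B 0 1 t).card) ∪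
        (X.filter fun t => 2 ^ R ≤ 3 * (B 1 2 t).card) := by
      intro x hx
      simp only [Finset.mem_sdiff, Finset.mem_filter, Finset.mem_union] at hx ⊢
      tauto
    have h3 : ((X \ ((X.filter fun t => ¬ 2 ^ R ≤ 3 * (B 0 1 t).card).filter
      fun t => ¬ 2 ^ R ≤ 3 * (B 1 2 t).card)).card : ℝ) ≤
        (X.filter fun t => 2 ^ R ≤ 3 * (B 0 1 t).card).card +
        (X.filter fun t => 2 ^ R ≤ 3 * (B 1 2 t).card).card := by
      exact_mod_cast (Finset.card_le_card this).trans (Finset.card_union_le _ _)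
    linarith
  · have h1 := hB 0 2 (by decide) Q (by rw [if_neg (by decide)])
    refine le_trans ?_ h1
    refine Nat.cast_le.2 (Finset.card_le_card fun x hx => ?_)
    simp only [Finset.mem_sdiff, Finset.mem_filter] at hx ⊢
    tauto
  · intro x hx y hy hxy
    simp only [Finset.mem_filter, not_le] at hx hy hxy
    -- Three bad sets, each smaller than a third of the space, leave a base point at which the
    -- surviving `x`, `y`, `x + y` span a triangle of `G'`.
    have hlt : (B 0 1 x ∪ (B 1 2 y).image (· + x) ∪ B 0 2 (x + y)).card
        < (Finset.univ : Finset (F2 R)).card := by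
      have h1 : (Finset.univ : Finset (F2 R)).card = 2 ^ R := by simp [Finset.card_univ, ZMod.card]
      have h2 := Finset.card_union_le (B 0 1 x ∪ (B 1 2 y).image (· + x)) (B 0 2 (x + y))
      have h3 := Finset.card_union_le (B 0 1 x) ((B 1 2 y).image (· + x))
      have h4 : ((B 1 2 y).image (· + x)).card ≤ (B 1 2 y).card := Finset.card_image_le
      omega
    obtain ⟨a, -, ha⟩ := Finset.exists_mem_notMem_of_card_lt_card hlt
    simp only [Finset.mem_union, not_or, B, Finset.mem_filter, Finset.mem_univ, true_and, not_not,
      Finset.mem_image, not_exists, not_and] at ha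
    have h01 := ha.1.1
    have h02 := ha.2
    have h12 : G'.Adj (1, a + x) (2, a + (x + y)) := by
      by_contra hcon
      refine ha.1.2 (a + x) (fun h => hcon ?_) ?_
      · rwa [add_assoc] at h
      · rw [add_assoc, ZModModule.add_self, add_zero]
    exact hfree {(0, a), (1, a + x), (2, a + (x + y))}
      (SimpleGraph.is3Clique_triple_iff.2 ⟨h01, h02, h12⟩)

/-- A set of more than `2 ^ d + ε 2 ^ R` elements has at least `2 ^ (d + 1) - ε 2 ^ R` popular
sums. -/
lemma exists_popular_sums {ε : ℝ} (hε : 0 < ε) :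
    ∃ τ : ℝ, 0 < τ ∧ τ ≤ 1 ∧ ∀ (R d : ℕ) (X : Finset (F2 R)), 2 ^ d + ε * 2 ^ R ≤ (X.card : ℝ) →
      (2 : ℝ) ^ (d + 1) ≤
        (Finset.univ.filter fun s => τ * 2 ^ R ≤ (repr2 X s : ℝ)).card + ε * 2 ^ R := by
  have hpos := SimpleGraph.triangleRemovalBound_pos (show 0 < ε / 100 by positivity)
  refine ⟨min 1 (SimpleGraph.triangleRemovalBound (ε / 100)), lt_min one_pos hpos, min_le_left _ _,
    fun R d X hX => ?_⟩
  set τ := min 1 (SimpleGraph.triangleRemovalBound (ε / 100))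
  set P := Finset.univ.filter fun s => τ * 2 ^ R ≤ (repr2 X s : ℝ)
  have hN : (0 : ℝ) < 2 ^ R := by positivity
  have hsum : ((∑ q ∈ Pᶜ, repr2 X q : ℕ) : ℝ) ≤ 2 ^ R * (τ * 2 ^ R) := by
    push_cast
    refine (Finset.sum_le_card_nsmul _ _ (τ * 2 ^ R) fun q hq => ?_).trans ?_
    · simp only [P, Finset.mem_compl, Finset.mem_filter, Finset.mem_univ, true_and, not_le] at hq
      exact hq.le
    · rw [nsmul_eq_mul]
      have hτ : 0 ≤ τ * 2 ^ R := mul_nonneg (le_min zero_le_one hpos.le) hN.le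
      refine mul_le_mul_of_nonneg_right ?_ hτ
      have : (Pᶜ).card ≤ 2 ^ R := by
        refine (Finset.card_le_univ _).trans ?_
        simp [ZMod.card]
      exact_mod_cast this
  obtain ⟨X', hX', Q', hQ', hXc, hQc, hfree⟩ := exists_sum_free_of_sum_repr2_lt (ε := ε / 100)
    (X := X) (Q := Pᶜ) (by
      push_cast at hsum ⊢
      have h1 : τ ≤ SimpleGraph.triangleRemovalBound (ε / 100) := min_le_right _ _
      have h3 : (0 : ℝ) < (2 ^ R) ^ 3 := by positivity
      have h2 : (2 : ℝ) ^ R * (2 ^ R * (τ * 2 ^ R)) ≤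
          SimpleGraph.triangleRemovalBound (ε / 100) * (2 ^ R) ^ 3 := by
        calc (2 : ℝ) ^ R * (2 ^ R * (τ * 2 ^ R)) = τ * (2 ^ R) ^ 3 := by ring
          _ ≤ _ := by gcongr
      have h4 := mul_pos hpos h3
      have h5 := mul_le_mul_of_nonneg_left hsum hN.le
      nlinarith)
  have hXcard : ((X \ X').card : ℝ) + X'.card = X.card := by
    exact_mod_cast Finset.card_sdiff_add_card_eq_card hX'
  -- With parameter `ε / 100` the removal costs `X` at most `54 / 100 * ε * 2 ^ R` elements and `Pᶜ`
  -- at most half as many.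
  have hpow : (2 : ℝ) ^ d < X'.card := by nlinarith
  have hpow' : 2 ^ d < X'.card := by exact_mod_cast hpow
  have hne : X'.Nonempty := Finset.card_pos.1 (Nat.zero_lt_of_lt hpow')
  have hS := two_pow_le_card_add (d + 1) hne hne (by rw [pow_succ]; omega)
  have hsub : X' + X' ⊆ P ∪ (Pᶜ \ Q') := by
    intro z hz
    obtain ⟨x, hx, y, hy, rfl⟩ := Finset.mem_add.1 hz
    have := hfree x hx y hy
    simp only [Finset.mem_union, Finset.mem_sdiff, Finset.mem_compl]
    tauto
  have hc := hS.trans ((Finset.card_le_card hsub).trans (Finset.card_union_le _ _))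
  have hc' : (2 : ℝ) ^ (d + 1) ≤ P.card + (Pᶜ \ Q').card := by exact_mod_cast hc
  nlinarith

end Removal

/-- For a set `U` of popular sums of `X`, some two small pieces of `X` have a sumset containing a
positive proportion of `U`. -/
lemma exists_pair_subset_cover {a b : ℕ} {τ : ℝ} (X U : Finset (F2 (a + b)))
    (hU : ∀ s ∈ U, τ * 2 ^ (a + b) ≤ (repr2 X s : ℝ)) :
    ∃ Y ⊆ X, ∃ Z ⊆ X, Y.card ≤ 2 ^ a ∧ Z.card ≤ 2 ^ b ∧ τ * U.card ≤ ((U ∩ (Y + Z)).card : ℝ) := by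
  classical
  -- The space splits into complements of dimensions `a` and `b`; `Y p` and `Z p` are the parts of
  -- `X` in the corresponding cosets through `p`. Each representation of `s` is captured by `2 ^ (a
  -- + b)` pairs of base points, so averaging over all pairs finds one covering a proportion `τ` of
  -- `U`.
  let E : F2 a → F2 (a + b) := fun e => Fin.append e 0
  let F : F2 b → F2 (a + b) := fun f => Fin.append 0 f
  let Y : F2 (a + b) → Finset (F2 (a + b)) := fun p =>
    X.filter fun x => ∃ e, x = p + E e
  let Z : F2 (a + b) → Finset (F2 (a + b)) := fun p =>
    X.filter fun x => ∃ f, x = p + F f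
  have hY : ∀ p, (Y p).card ≤ 2 ^ a := by
    intro p
    have : Y p ⊆ Finset.univ.image fun e => p + E e := by
      intro x hx
      obtain ⟨e, rfl⟩ := (Finset.mem_filter.1 hx).2
      exact Finset.mem_image_of_mem _ (Finset.mem_univ _)
    refine (Finset.card_le_card this).trans (Finset.card_image_le.trans ?_)
    simp [ZMod.card]
  have hZ : ∀ p, (Z p).card ≤ 2 ^ b := by
    intro p
    have : Z p ⊆ Finset.univ.image fun f => p + F f := by
      intro x hx
      obtain ⟨e, rfl⟩ := (Finset.mem_filter.1 hx).2
      exact Finset.mem_image_of_mem _ (Finset.mem_univ _)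
    refine (Finset.card_le_card this).trans (Finset.card_image_le.trans ?_)
    simp [ZMod.card]
  have hself : ∀ x y : F2 (a + b), x + (x + y) = y := fun x y => by
    rw [← add_assoc, ZModModule.add_self, zero_add]
  have hself' : ∀ x y : F2 (a + b), x + y + y = x := fun x y => by
    rw [add_assoc, ZModModule.add_self, add_zero]
  have hcount : ∀ s, 2 ^ (a + b) * repr2 X s ≤
      (Finset.univ.filter fun p : F2 (a + b) × F2 (a + b) => s ∈ Y p.1 + Z p.2).card := by
    intro s
    have h1 : 2 ^ (a + b) * repr2 X s =
        ((Finset.univ : Finset (F2 a × F2 b)) ×ˢ (X.filter fun x => s + x ∈ X)).card := by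
      rw [Finset.card_product, repr2, Finset.card_univ, Fintype.card_prod]
      simp [ZMod.card, pow_add]
    rw [h1]
    refine Finset.card_le_card_of_injOn
      (fun q => (q.2 + E q.1.1, s + q.2 + F q.1.2)) ?_ ?_
    · rintro ⟨⟨e, f⟩, y⟩ hq
      simp only [Finset.coe_product, Set.mem_prod, Finset.mem_coe, Finset.mem_filter] at hq
      simp only [Finset.coe_filter, Finset.mem_univ, true_and, Set.mem_ofPred_eq]
      refine Finset.mem_add.2 ⟨y, Finset.mem_filter.2 ⟨hq.2.1, e, (hself' _ _).symm⟩, s + y,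
        Finset.mem_filter.2 ⟨hq.2.2, f, (hself' _ _).symm⟩, ?_⟩
      rw [add_comm s, hself]
    · rintro ⟨⟨e, f⟩, y⟩ - ⟨⟨e', f'⟩, y'⟩ - h
      simp only [Prod.mk.injEq] at h
      have hEF : ∀ e f, E e + F f = Fin.append e f := by
        intro e f
        rw [← Fin.append_add, add_zero, zero_add]
      have h2 : E e + F f = E e' + F f' := by
        have h3 : ∀ y e f, (y + E e) + (s + y + F f) = s + (E e + F f) := by
          intro y e f
          calc (y + E e) + (s + y + F f) = (y + y) + (s + (E e + F f)) := by abel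
            _ = _ := by rw [ZModModule.add_self, zero_add]
        have h4 := h3 y e f
        rw [h.1, h.2, h3] at h4
        exact (add_left_cancel h4).symm
      rw [hEF, hEF, Fin.append_inj_iff'] at h2
      obtain ⟨rfl, rfl⟩ := h2
      rw [add_right_cancel h.1]
  have hsum : (∑ p : F2 (a + b) × F2 (a + b), τ * U.card)
      ≤ ∑ p : F2 (a + b) × F2 (a + b), ((U ∩ (Y p.1 + Z p.2)).card : ℝ) := by
    have h1 : ∑ p : F2 (a + b) × F2 (a + b), ((U ∩ (Y p.1 + Z p.2)).card : ℝ) =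
        ∑ s ∈ U, ((Finset.univ.filter fun p : F2 (a + b) × F2 (a + b) =>
          s ∈ Y p.1 + Z p.2).card : ℝ) := by
      simp_rw [← Finset.filter_mem_eq_inter, Finset.card_filter]
      push_cast
      exact Finset.sum_comm
    have h2 : ∀ s ∈ U, (2 : ℝ) ^ (a + b) * (τ * 2 ^ (a + b)) ≤
        ((Finset.univ.filter fun p : F2 (a + b) × F2 (a + b) => s ∈ Y p.1 + Z p.2).card : ℝ) := by
      intro s hs
      calc (2 : ℝ) ^ (a + b) * (τ * 2 ^ (a + b)) ≤ 2 ^ (a + b) * (repr2 X s : ℝ) := by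
            gcongr; exact hU s hs
        _ ≤ _ := by exact_mod_cast hcount s
    rw [h1]
    refine le_trans (le_of_eq ?_) (Finset.card_nsmul_le_sum _ _ _ h2)
    rw [Finset.sum_const, Finset.card_univ, Fintype.card_prod]
    simp [ZMod.card]
    ring
  obtain ⟨p, -, hp⟩ := Finset.exists_le_of_sum_le Finset.univ_nonempty hsum
  exact ⟨Y p.1, Finset.filter_subset _ _, Z p.2, Finset.filter_subset _ _, hY _, hZ _, hp⟩

/-- Greedy iteration: each round covers a proportion `τ` of the popular sums still missing. -/
lemma exists_subset_cover_popular {a b : ℕ} {τ : ℝ} (hτ1 : τ ≤ 1)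
    (X P : Finset (F2 (a + b))) (hP : ∀ s ∈ P, τ * 2 ^ (a + b) ≤ (repr2 X s : ℝ)) (m : ℕ) :
    ∃ Y ⊆ X, Y.card ≤ m * (2 ^ a + 2 ^ b) ∧ ((P \ (Y + Y)).card : ℝ) ≤ (1 - τ) ^ m * P.card := by
  classical
  induction m with
  | zero => exact ⟨∅, by simp, by simp, by simp⟩
  | succ m ih =>
    obtain ⟨Y, hYX, hYc, hY⟩ := ih
    obtain ⟨Z, hZ, W, hW, hZc, hWc, hZW⟩ := exists_pair_subset_cover X (P \ (Y + Y))
      fun s hs => hP s (Finset.mem_sdiff.1 hs).1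
    refine ⟨Y ∪ (Z ∪ W), Finset.union_subset hYX (Finset.union_subset hZ hW), ?_, ?_⟩
    · have h1 := Finset.card_union_le Y (Z ∪ W)
      have h2 := Finset.card_union_le Z W
      rw [add_mul, one_mul]
      omega
    · have hsub : P \ ((Y ∪ (Z ∪ W)) + (Y ∪ (Z ∪ W))) ⊆ (P \ (Y + Y)) \ (Z + W) := by
        intro s hs
        rw [Finset.mem_sdiff] at hs
        rw [Finset.mem_sdiff, Finset.mem_sdiff]
        refine ⟨⟨hs.1, fun h => hs.2 ?_⟩, fun h => hs.2 ?_⟩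
        · exact Finset.add_subset_add Finset.subset_union_left Finset.subset_union_left h
        · exact Finset.add_subset_add
            (Finset.subset_union_left.trans Finset.subset_union_right)
            (Finset.subset_union_right.trans Finset.subset_union_right) h
      have hc : ((P \ ((Y ∪ (Z ∪ W)) + (Y ∪ (Z ∪ W)))).card : ℝ) ≤
          ((P \ (Y + Y)) \ (Z + W)).card := by exact_mod_cast Finset.card_le_card hsub
      have hc2 : (((P \ (Y + Y)) \ (Z + W)).card : ℝ) + ((P \ (Y + Y)) ∩ (Z + W)).card
          = (P \ (Y + Y)).card := by
        exact_mod_cast Finset.card_sdiff_add_card_inter _ _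
      have h1 : (0 : ℝ) ≤ 1 - τ := by linarith
      have := mul_le_mul_of_nonneg_left hY h1
      rw [pow_succ]
      nlinarith

/-- A dense set `X` with more than `(1 + ε) 2 ^ d` elements contains a small subset whose sumset has
almost `2 ^ (d + 1)` elements. -/
theorem exists_small_subset_large_sumset {ε : ℝ} (hε : 0 < ε) :
    ∃ M : ℕ, ∀ (R d : ℕ) (X : Finset (F2 R)), 2 ^ d + ε * 2 ^ R ≤ (X.card : ℝ) →
      ∃ Y ⊆ X, Y.card ≤ M * 2 ^ (R / 2) ∧ (2 : ℝ) ^ (d + 1) ≤ (Y + Y).card + ε * 2 ^ R := by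
  obtain ⟨τ, hτ0, hτ1, hpop⟩ := exists_popular_sums (half_pos hε)
  obtain ⟨m, hm⟩ := exists_pow_lt_of_lt_one (half_pos hε) (show 1 - τ < 1 by linarith)
  -- Halving `R` balances the two pieces; for odd `R` one of them is twice as large, whence the `3`.
  refine ⟨3 * m, fun R d X hX => ?_⟩
  obtain ⟨a, b, rfl, hab, hb⟩ : ∃ a b, R = a + b ∧ (a + b) / 2 = a ∧ b ≤ a + 1 :=
    ⟨R / 2, R - R / 2, by omega, by omega, by omega⟩
  have hN : (0 : ℝ) < 2 ^ (a + b) := by positivity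
  have hp := hpop (a + b) d X (by nlinarith)
  obtain ⟨Y, hYX, hYc, hY⟩ := exists_subset_cover_popular hτ1 X
    (Finset.univ.filter fun s => τ * 2 ^ (a + b) ≤ (repr2 X s : ℝ))
    (fun s hs => (Finset.mem_filter.1 hs).2) m
  refine ⟨Y, hYX, ?_, ?_⟩
  · refine hYc.trans ?_
    have : 2 ^ b ≤ 2 * 2 ^ a := by
      rw [← pow_succ']; exact Nat.pow_le_pow_right (by norm_num) hb
    rw [hab]
    nlinarith
  · set P := Finset.univ.filter fun s => τ * 2 ^ (a + b) ≤ (repr2 X s : ℝ)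
    have h1 : (P.card : ℝ) ≤ 2 ^ (a + b) := by
      have : P.card ≤ 2 ^ (a + b) := by
        refine (Finset.card_le_univ _).trans ?_
        simp [ZMod.card]
      exact_mod_cast this
    have h2 : (P.card : ℝ) ≤ (P \ (Y + Y)).card + (Y + Y).card := by
      have := Finset.card_le_card_sdiff_add_card (s := P) (t := Y + Y)
      exact_mod_cast this
    have h3 : (1 - τ) ^ m * (P.card : ℝ) ≤ ε / 2 * 2 ^ (a + b) := by
      calc (1 - τ) ^ m * (P.card : ℝ) ≤ ε / 2 * P.card := by gcongr
        _ ≤ _ := by gcongr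
    linarith

/-! ### Union bounds over embeddings. -/

/-- Union bound over the images of the sets of a family `𝒵` under all embeddings of `𝔽₂ᴿ` in
`𝔽₂ⁿ`. -/
lemma randomSetLaw_real_exists_embedding_le {n R T : ℕ} (𝒵 : Finset (Finset (F2 R)))
    (h𝒵 : ∀ Z ∈ 𝒵, T ≤ Z.card) :
    (randomSetLaw n).real {A | ∃ v : Fin R → F2 n, LinearIndependent (ZMod 2) v ∧ ∃ Z ∈ 𝒵,
      (((Z.image (Fintype.linearCombination (ZMod 2) v)).erase 0 : Finset (F2 n)) : Set (F2 n)) ⊆ A}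
      ≤ 2 ^ (n * R) * 𝒵.card * (2 * (1 / 2 : ℝ) ^ T) := by
  classical
  let I : Finset ((Fin R → F2 n) × Finset (F2 R)) :=
    (Finset.univ.filter fun v => LinearIndependent (ZMod 2) v) ×ˢ 𝒵
  have h1 := randomSetLaw_real_exists_superset_le I
    (fun p => (p.2.image (Fintype.linearCombination (ZMod 2) p.1)).erase 0)
  refine (measureReal_mono ?_).trans (h1.trans ?_)
  · rintro A ⟨v, hv, Z, hZ, h⟩
    exact ⟨(v, Z), Finset.mem_product.2 ⟨Finset.mem_filter.2 ⟨Finset.mem_univ _, hv⟩, hZ⟩, h⟩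
  have h2 : ∀ p ∈ I, (1 / 2 : ℝ) ^ ((p.2.image (Fintype.linearCombination (ZMod 2) p.1)).erase 0).card
      ≤ 2 * (1 / 2 : ℝ) ^ T := by
    rintro ⟨v, Z⟩ hp
    obtain ⟨hv, hZ⟩ := Finset.mem_product.1 hp
    have hv := (Finset.mem_filter.1 hv).2
    have hinj : Function.Injective (Fintype.linearCombination (ZMod 2) v) :=
      linearIndependent_iff_injective_fintypeLinearCombination.1 hv
    -- Erasing `0` may lose one element, which the factor `2` in the bound pays for.
    have h3 : T ≤ ((Z.image (Fintype.linearCombination (ZMod 2) v)).erase 0).card + 1 := by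
      refine (h𝒵 Z hZ).trans ?_
      rw [← Finset.card_image_of_injective Z hinj]
      have := Finset.pred_card_le_card_erase (s := Z.image (Fintype.linearCombination (ZMod 2) v))
        (a := 0)
      omega
    have h4 : (1 / 2 : ℝ) ^ (((Z.image (Fintype.linearCombination (ZMod 2) v)).erase 0).card + 1)
        ≤ (1 / 2 : ℝ) ^ T := pow_le_pow_of_le_one (by norm_num) (by norm_num) h3
    rw [pow_succ] at h4
    linarith
  refine (Finset.sum_le_card_nsmul _ _ _ h2).trans ?_
  rw [nsmul_eq_mul]
  gcongr
  have h5 : I.card ≤ 2 ^ (n * R) * 𝒵.card := by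
    rw [Finset.card_product]
    gcongr
    refine (Finset.card_filter_le _ _).trans ?_
    simp [Finset.card_univ, ZMod.card, pow_mul]
  exact_mod_cast h5

/-- Every set containing the origin is the image under an embedding of a set containing the origin
and the standard basis. -/
lemma exists_coordinates {n : ℕ} {X : Finset (F2 n)} (h0 : 0 ∈ X) :
    ∃ (R : ℕ) (v : Fin R → F2 n) (Y : Finset (F2 R)), R ≤ n ∧ LinearIndependent (ZMod 2) v ∧ 0 ∈ Y ∧
      (∀ i, Pi.single i 1 ∈ Y) ∧ Y.image (Fintype.linearCombination (ZMod 2) v) = X := by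
  classical
  obtain ⟨b, hbX, hbs, hb⟩ := exists_linearIndependent (ZMod 2) (X : Set (F2 n))
  have hbf : Finite b := Set.Finite.subset X.finite_toSet hbX
  obtain ⟨R, ⟨e⟩⟩ := Finite.exists_equiv_fin b
  let v : Fin R → F2 n := fun i => (e.symm i : F2 n)
  have hv : LinearIndependent (ZMod 2) v := hb.comp _ e.symm.injective
  have hinj := linearIndependent_iff_injective_fintypeLinearCombination.1 hv
  have hrange : Set.range v = b := by
    ext x
    constructor
    · rintro ⟨i, rfl⟩; exact (e.symm i).2
    · intro hx; exact ⟨e ⟨x, hx⟩, by simp [v]⟩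
  have hsingle : ∀ i, Fintype.linearCombination (ZMod 2) v (Pi.single i 1) = v i := by
    intro i
    simp [Fintype.linearCombination_apply_single]
  refine ⟨R, v, X.preimage _ hinj.injOn, ?_, hv, ?_, fun i => ?_, ?_⟩
  · simpa using hv.fintype_card_le_finrank
  · simpa using h0
  · rw [Finset.mem_preimage, hsingle]
    exact hbX (hrange ▸ Set.mem_range_self i)
  · rw [Finset.image_preimage, Finset.filter_eq_self]
    intro x hx
    have : x ∈ Submodule.span (ZMod 2) (Set.range v) := by
      rw [hrange, hbs]; exact Submodule.subset_span hx
    rwa [← Fintype.range_linearCombination] at this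

lemma image_linearCombination_add {n R : ℕ} (v : Fin R → F2 n) (Y : Finset (F2 R)) :
    (Y + Y).image (Fintype.linearCombination (ZMod 2) v) =
      Y.image (Fintype.linearCombination (ZMod 2) v) +
        Y.image (Fintype.linearCombination (ZMod 2) v) :=
  Finset.image_add (Fintype.linearCombination (ZMod 2) v)

/-- Here `Y` spans the whole space, so bounded doubling makes it dense. -/
lemma two_pow_le_of_card_add_self_le {R K : ℕ} {Y : Finset (F2 R)} (h0 : 0 ∈ Y)
    (h1 : ∀ i, Pi.single i 1 ∈ Y) (hK : (Y + Y).card ≤ K * Y.card) :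
    2 ^ R ≤ 2 ^ K ^ 4 * (K * Y.card) := by
  have h := two_pow_finrank_span_le h0 hK
  have : Submodule.span (ZMod 2) (Y : Set (F2 R)) = ⊤ := by
    rw [eq_top_iff, ← (Pi.basisFun (ZMod 2) (Fin R)).span_eq]
    refine Submodule.span_mono ?_
    rintro _ ⟨i, rfl⟩
    rw [Pi.basisFun_apply]
    exact h1 i
  rw [this, finrank_top] at h
  simpa using h

/-- A single term of the binomial expansion of `(1/64 + 1)^(2s)` gives `64^k (65/64)^(2s)`; the two
factors are at most `2^(3s/16)` and `2^(s/16)`. -/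
lemma choose_two_mul_pow_le {s k : ℕ} (h : 32 * k ≤ s) :
    ((2 * s).choose k : ℝ) ≤ (2 : ℝ) ^ ((s : ℝ) / 4) := by
  have hk : k ≤ 2 * s := by omega
  have h1 : ((2 * s).choose k : ℝ) ≤ 64 ^ k * (65 / 64 : ℝ) ^ (2 * s) := by
    have := Finset.single_le_sum (f := fun m => (1 / 64 : ℝ) ^ m * 1 ^ (2 * s - m) * (2 * s).choose m)
      (fun m _ => by positivity) (Finset.mem_range.2 (Nat.lt_succ_of_le hk))
    rw [← add_pow] at this
    simp only [one_pow, mul_one] at this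
    have h64 : (1 / 64 : ℝ) + 1 = 65 / 64 := by norm_num
    rw [h64] at this
    calc ((2 * s).choose k : ℝ) = 64 ^ k * ((1 / 64) ^ k * (2 * s).choose k) := by
          rw [← mul_assoc, ← mul_pow]; norm_num
      _ ≤ _ := by gcongr
  have h2 : (64 : ℝ) ^ k ≤ (2 : ℝ) ^ ((s : ℝ) * (3 / 16)) := by
    have : (64 : ℝ) ^ k = (2 : ℝ) ^ ((6 * k : ℕ) : ℝ) := by
      rw [Real.rpow_natCast, pow_mul]; norm_num
    rw [this]
    refine Real.rpow_le_rpow_of_exponent_le one_le_two ?_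
    have : (32 : ℝ) * k ≤ s := by exact_mod_cast h
    push_cast
    linarith
  have h3 : (65 / 64 : ℝ) ^ (2 * s) ≤ (2 : ℝ) ^ ((s : ℝ) * (1 / 16)) := by
    have h32 : (65 / 64 : ℝ) ^ 2 ≤ (2 : ℝ) ^ (1 / 16 : ℝ) := by
      rw [← Real.pow_rpow_inv_natCast (x := (65 / 64 : ℝ) ^ 2) (by norm_num) (show 16 ≠ 0 by norm_num)]
      have h16 : ((16 : ℕ) : ℝ)⁻¹ = 1 / 16 := by norm_num
      rw [h16]
      exact Real.rpow_le_rpow (by positivity) (by norm_num) (by norm_num)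
    rw [pow_mul, mul_comm, Real.rpow_mul (by norm_num), Real.rpow_natCast]
    gcongr
  calc ((2 * s).choose k : ℝ) ≤ 64 ^ k * (65 / 64 : ℝ) ^ (2 * s) := h1
    _ ≤ (2 : ℝ) ^ ((s : ℝ) * (3 / 16)) * (2 : ℝ) ^ ((s : ℝ) * (1 / 16)) := by gcongr
    _ = _ := by rw [← Real.rpow_add (by norm_num)]; congr 1; ring

/-- It is unlikely that the random set contains the nonzero sums of a set of size `k` with large
sumset. -/
lemma randomSetLaw_real_exists_large_sumset_le {n R k s : ℕ} (hR : 1 ≤ R) (hRn : R ≤ n)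
    (hRk : 32 * R ≤ k) (hs : 512 * (n * R) ≤ s) (hks : 32 * k ≤ s) :
    (randomSetLaw n).real {A | ∃ v : Fin R → F2 n, LinearIndependent (ZMod 2) v ∧
      ∃ Z ∈ (Finset.univ.filter fun X : Finset (F2 R) => X.card = k ∧ (X + X).card = s).image
        (fun X => X + X),
      (((Z.image (Fintype.linearCombination (ZMod 2) v)).erase 0 : Finset (F2 n)) : Set (F2 n)) ⊆ A}
      ≤ 2 * (2 : ℝ) ^ (-(s : ℝ) / 2) := by
  refine (randomSetLaw_real_exists_embedding_le (T := s) _ ?_).trans ?_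
  · intro Z hZ
    obtain ⟨X, hX, rfl⟩ := Finset.mem_image.1 hZ
    exact (Finset.mem_filter.1 hX).2.2.ge
  have h1 : ((((Finset.univ.filter fun X : Finset (F2 R) => X.card = k ∧ (X + X).card = s).image
      (fun X => X + X)).card : ℕ) : ℝ) ≤ 2 ^ (R * (2 * (16 * R) + s / (16 * R))) * (2 * s).choose k := by
    have := (Finset.card_image_le (f := fun X : Finset (F2 R) => X + X)).trans (card_filter_card_add_self_le (V := F2 R) (g := 16 * R) (k := k)
      (s := s) (by omega) (by omega))
    have hc : Fintype.card (F2 R) = 2 ^ R := by simp [ZMod.card]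
    rw [hc, ← pow_mul] at this
    exact_mod_cast this
  have h2 : R * (2 * (16 * R) + s / (16 * R)) ≤ 32 * (n * R) + s / 16 := by
    have h3 : R * (s / (16 * R)) ≤ s / 16 := by
      rw [← Nat.div_div_eq_div_mul]
      exact Nat.mul_div_le _ _
    have h4 : R * R ≤ n * R := Nat.mul_le_mul_right _ hRn
    rw [mul_add]
    nlinarith
  -- With `g = 16 * R` the container description costs at most `32 * (n * R) + s / 16` bits. As `512
  -- * (n * R) ≤ s`, all choices together use at most half of the exponent `s`.
  have h5 : ((n * R : ℕ) : ℝ) + ((R * (2 * (16 * R) + s / (16 * R)) : ℕ) : ℝ) + (s : ℝ) / 4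
      ≤ (s : ℝ) / 2 := by
    have h6 : 16 * (n * R + R * (2 * (16 * R) + s / (16 * R))) ≤ 4 * s := by omega
    have h7 : (16 : ℝ) * ((n * R : ℕ) + (R * (2 * (16 * R) + s / (16 * R)) : ℕ)) ≤ 4 * s := by
      exact_mod_cast h6
    linarith
  calc _ ≤ (2 : ℝ) ^ (n * R) * (2 ^ (R * (2 * (16 * R) + s / (16 * R))) * (2 : ℝ) ^ ((s : ℝ) / 4))
        * (2 * (1 / 2 : ℝ) ^ s) := by
        gcongr
        exact h1.trans (mul_le_mul_of_nonneg_left (choose_two_mul_pow_le hks) (by positivity))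
    _ = 2 * (2 : ℝ) ^ (((n * R : ℕ) : ℝ) + ((R * (2 * (16 * R) + s / (16 * R)) : ℕ) : ℝ)
        + (s : ℝ) / 4 - s) := by
        rw [Real.rpow_sub two_pos, Real.rpow_add two_pos, Real.rpow_add two_pos, Real.rpow_natCast,
          Real.rpow_natCast, Real.rpow_natCast, one_div, inv_pow]
        ring
    _ ≤ _ := by
        gcongr
        · exact one_le_two
        · linarith

/-- It is unlikely that the random set contains the nonzero sums of a small set with large
sumset in a subspace of small dimension. -/
lemma randomSetLaw_real_exists_small_le {n R m T : ℕ} :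
    (randomSetLaw n).real {A | ∃ v : Fin R → F2 n, LinearIndependent (ZMod 2) v ∧
      ∃ Z ∈ ((Finset.univ : Finset (Fin m → F2 R)).image
        (fun f => Finset.univ.image f + Finset.univ.image f)).filter (fun Z => T ≤ Z.card),
      (((Z.image (Fintype.linearCombination (ZMod 2) v)).erase 0 : Finset (F2 n)) : Set (F2 n)) ⊆ A}
      ≤ 2 * (2 : ℝ) ^ (((n * R + R * m : ℕ) : ℝ) - T) := by
  refine (randomSetLaw_real_exists_embedding_le (T := T) _ ?_).trans ?_
  · intro Z hZ
    exact (Finset.mem_filter.1 hZ).2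
  have h1 : (((((Finset.univ : Finset (Fin m → F2 R)).image
        (fun f => Finset.univ.image f + Finset.univ.image f)).filter
        (fun Z => T ≤ Z.card)).card : ℕ) : ℝ) ≤ 2 ^ (R * m) := by
    have : (((Finset.univ : Finset (Fin m → F2 R)).image
        (fun f => Finset.univ.image f + Finset.univ.image f)).filter
        (fun Z => T ≤ Z.card)).card ≤ 2 ^ (R * m) := by
      refine (Finset.card_filter_le _ _).trans (Finset.card_image_le.trans ?_)
      simp [Finset.card_univ, ZMod.card, pow_mul]
    exact_mod_cast this
  calc _ ≤ (2 : ℝ) ^ (n * R) * 2 ^ (R * m) * (2 * (1 / 2 : ℝ) ^ T) := by gcongr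
    _ = _ := by
        rw [Real.rpow_sub two_pos, Real.rpow_natCast, Real.rpow_natCast, pow_add, one_div, inv_pow]
        ring

/-! ### Asymptotic estimates. -/

lemma tendsto_logb_natCast : Tendsto (fun n : ℕ => Real.logb 2 (n : ℝ)) atTop atTop :=
  (Real.tendsto_logb_atTop one_lt_two).comp tendsto_natCast_atTop_atTop

lemma eventually_logb_le_mul {c : ℝ} (hc : 0 < c) : ∀ᶠ x : ℝ in atTop, Real.logb 2 x ≤ c * x := by
  have hl : 0 < Real.log 2 := Real.log_pos one_lt_two
  filter_upwards [Real.isLittleO_log_id_atTop.def (c := c * Real.log 2) (by positivity),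
    eventually_ge_atTop 1] with x hx hx1
  rw [Real.norm_of_nonneg (Real.log_nonneg hx1), id, Real.norm_of_nonneg (by linarith)] at hx
  rw [Real.logb, div_le_iff₀ hl]
  linarith

/-- If the sumset of a set of about `n log n` elements is not much larger than `n` times the rank,
then the set has bounded doubling. -/
lemma exists_card_add_self_le_mul : ∃ K : ℕ, ∀ᶠ n : ℕ in atTop, ∀ (R : ℕ) (Y : Finset (F2 R)),
    0 ∈ Y → (∀ i, Pi.single i 1 ∈ Y) → nlog n ≤ 2 * Y.card → Y.card ≤ n ^ 2 →
    ¬ (512 * (n * R) ≤ (Y + Y).card ∧ 32 * Y.card ≤ (Y + Y).card) →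
    (Y + Y).card ≤ K * Y.card := by
  refine ⟨2 ^ 30, ?_⟩
  filter_upwards [tendsto_logb_natCast.eventually_ge_atTop (2 ^ 15), eventually_ge_atTop 1]
    with n hn hn1 R Y h0 h1 hL hk hcase
  by_contra hcon
  push Not at hcon
  set k := Y.card with hkdef
  set s := (Y + Y).card with hs
  set l := Real.logb 2 (n : ℝ) with hl
  have hs2 : s < 512 * (n * R) := by
    by_contra h
    exact hcase ⟨not_lt.1 h, by omega⟩
  have hn0 : (0 : ℝ) < n := by exact_mod_cast hn1
  have hL' : (n : ℝ) * l ≤ 2 * k := hL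
  have hkpos : (0 : ℝ) < k := by nlinarith
  have hs2' : (s : ℝ) < 512 * (n * R) := by exact_mod_cast hs2
  have hcon' : (2 : ℝ) ^ 30 * k < s := by exact_mod_cast hcon
  -- If doubling exceeded `2 ^ 30`, the bound `s < 512 * (n * R)` would force a rank far above `log
  -- n`. Either alternative of the Freiman-type inequality then fails: the first would give `R ≤ 2 ^
  -- 18 * l`, the second `k ≤ 8192 * n`.
  have hR : (2 : ℝ) ^ 20 * l < R := by
    have : (n : ℝ) * (2 ^ 20 * l) < n * R := by nlinarith
    exact lt_of_mul_lt_mul_left this hn0.le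
  have hR4 : 4 ≤ R := by
    have : (4 : ℝ) ≤ R := by nlinarith
    exact_mod_cast this
  have hkne : k ≠ 0 := by rintro h; rw [h] at hkpos; simp at hkpos
  have hw : ((Nat.log 2 k : ℕ) : ℝ) ≤ 2 * l := by
    have h2 : (2 : ℝ) ^ (Nat.log 2 k : ℕ) ≤ (n : ℝ) ^ 2 := by
      exact_mod_cast (Nat.pow_log_le_self 2 hkne).trans hk
    have h3 := Real.logb_le_logb_of_le (b := 2) one_lt_two (by positivity) h2
    rw [Real.logb_pow, Real.logb_pow, Real.logb_self_eq_one one_lt_two] at h3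
    push_cast at h3
    linarith
  rcases card_mul_le_card_add_self h0 h1 with h | h
  · rw [← hkdef, ← hs] at h
    set w := Nat.log 2 k
    have hm : (R : ℝ) / 4 + 1 ≤ ((R / 2 - w : ℕ) : ℝ) := by
      have h2 : R ≤ 2 * (R / 2 - w) + 2 * w + 1 := by omega
      have h3 : (R : ℝ) ≤ 2 * ((R / 2 - w : ℕ) : ℝ) + 2 * w + 1 := by exact_mod_cast h2
      linarith
    have h' : (k : ℝ) * ((R / 2 - w).choose 2 : ℕ) ≤ ((w + 2).choose 2 : ℕ) * s := by
      exact_mod_cast h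
    rw [Nat.cast_choose_two, Nat.cast_choose_two] at h'
    push_cast at h'
    have hw0 : (0 : ℝ) ≤ w := by positivity
    have hl0 : 0 < l := by linarith
    have h4 : ((w : ℝ) + 2) * (w + 2 - 1) / 2 ≤ 8 * l ^ 2 := by nlinarith
    have h5 : (R : ℝ) ^ 2 / 32 ≤ ((R / 2 - w : ℕ) : ℝ) * (((R / 2 - w : ℕ) : ℝ) - 1) / 2 := by
      have : (0 : ℝ) ≤ R := by positivity
      nlinarith
    have h6 : (k : ℝ) * ((R : ℝ) ^ 2 / 32) ≤ 8 * l ^ 2 * (512 * (n * R)) := by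
      calc (k : ℝ) * ((R : ℝ) ^ 2 / 32) ≤ _ := mul_le_mul_of_nonneg_left h5 hkpos.le
        _ ≤ _ := h'
        _ ≤ 8 * l ^ 2 * s := mul_le_mul_of_nonneg_right h4 (by positivity)
        _ ≤ _ := mul_le_mul_of_nonneg_left hs2'.le (by positivity)
    have hRpos : (0 : ℝ) < R := by exact_mod_cast (by omega : 0 < R)
    have h7 : (n : ℝ) * l * R * R ≤ n * l * R * (2 ^ 18 * l) := by
      have : (n : ℝ) * l * (R ^ 2 / 32) ≤ 2 * (k * (R ^ 2 / 32)) := by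
        have := mul_le_mul_of_nonneg_right hL' (show (0 : ℝ) ≤ R ^ 2 / 32 by positivity)
        linarith
      nlinarith
    have h8 := le_of_mul_le_mul_left h7 (by positivity)
    nlinarith
  · rw [← hkdef, ← hs] at h
    have h2 : k * R ≤ 8192 * n * R := by
      have : R ≤ 8 * (R / 4) := by omega
      calc k * R ≤ k * (8 * (R / 4)) := Nat.mul_le_mul_left _ this
        _ = 8 * (k * (R / 4)) := by ring
        _ ≤ 8 * (2 * s) := Nat.mul_le_mul_left _ h
        _ ≤ 8 * (2 * (512 * (n * R))) := by gcongr
        _ = _ := by ring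
    have h3 : k ≤ 8192 * n := Nat.le_of_mul_le_mul_right h2 (by omega)
    have h4 : (k : ℝ) ≤ 8192 * n := by exact_mod_cast h3
    nlinarith

/-- `2^R = O(n log n)` gives `R ≤ (1 + o(1)) log n` and `2^(R/2) = o(n)`, so the cost of the small
subset is negligible beside the cost `n R` of the embedding. -/
lemma eventually_mul_add_mul_le {C δ : ℝ} (hC : 0 < C) (hδ : 0 < δ) (M : ℕ) :
    ∀ᶠ n : ℕ in atTop, ∀ R : ℕ, (2 : ℝ) ^ R ≤ C * nlog n →
      ((n * R + R * (M * 2 ^ (R / 2)) : ℕ) : ℝ) ≤ (1 + δ) * nlog n := by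
  have hc : 0 < δ ^ 2 / (16 * (M + 1) ^ 2 * C * (1 + δ) ^ 2) := by positivity
  filter_upwards [tendsto_logb_natCast.eventually_ge_atTop 1, eventually_ge_atTop 1,
    tendsto_logb_natCast.eventually (eventually_logb_le_mul (show 0 < δ / 4 by positivity)),
    tendsto_logb_natCast.eventually_ge_atTop (4 * Real.logb 2 C / δ),
    tendsto_natCast_atTop_atTop.eventually (eventually_logb_le_mul hc)]
    with n hl1 hn1 hll hlC hln R hR
  set l := Real.logb 2 (n : ℝ) with hl
  have hn0 : (0 : ℝ) < n := by exact_mod_cast hn1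
  have hR' : (2 : ℝ) ^ R ≤ C * (n * l) := hR
  have h1 : (R : ℝ) ≤ (1 + δ / 2) * l := by
    have h3 := Real.logb_le_logb_of_le (b := 2) one_lt_two (by positivity) hR'
    rw [Real.logb_pow, Real.logb_self_eq_one one_lt_two, Real.logb_mul hC.ne' (by positivity),
      Real.logb_mul hn0.ne' (by positivity), ← hl] at h3
    have h4 : Real.logb 2 C ≤ δ / 4 * l := by
      rw [div_le_iff₀ hδ] at hlC; linarith
    linarith
  have h2 : (M : ℝ) * 2 ^ (R / 2) * (1 + δ) ≤ δ / 2 * n := by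
    have h5 : ((2 : ℝ) ^ (R / 2)) ^ 2 ≤ C * (n * l) := by
      rw [← pow_mul]
      exact (pow_le_pow_right₀ one_le_two (Nat.div_mul_le_self R 2)).trans hR'
    have h6 : C * (n * l) ≤ δ ^ 2 / (16 * (M + 1) ^ 2 * (1 + δ) ^ 2) * n ^ 2 := by
      calc C * (n * l) ≤ C * (n * (δ ^ 2 / (16 * (M + 1) ^ 2 * C * (1 + δ) ^ 2) * n)) := by gcongr
        _ = _ := by field_simp
    have h7 : ((2 : ℝ) ^ (R / 2)) ^ 2 ≤ (δ / (4 * (M + 1) * (1 + δ)) * n) ^ 2 := by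
      refine (h5.trans h6).trans (le_of_eq ?_)
      field_simp
      ring
    have h8 := (pow_le_pow_iff_left₀ (by positivity) (by positivity) two_ne_zero).1 h7
    calc (M : ℝ) * 2 ^ (R / 2) * (1 + δ) ≤ (M + 1) * (δ / (4 * (M + 1) * (1 + δ)) * n) * (1 + δ) := by
          gcongr; linarith
      _ = δ / 4 * n := by field_simp
      _ ≤ _ := by nlinarith
  push_cast
  have h9 : (R : ℝ) * (M * 2 ^ (R / 2)) ≤ l * (δ / 2 * n) := by
    calc (R : ℝ) * (M * 2 ^ (R / 2)) ≤ ((1 + δ) * l) * (M * 2 ^ (R / 2)) := by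
          gcongr
          nlinarith
      _ = l * (M * 2 ^ (R / 2) * (1 + δ)) := by ring
      _ ≤ _ := by gcongr
  have h10 : (n : ℝ) * R ≤ n * ((1 + δ / 2) * l) := by gcongr
  have h11 : nlog n = n * l := rfl
  rw [h11]
  nlinarith

lemma tendsto_poly_mul_two_rpow_neg :
    Tendsto (fun n : ℕ => 8 * ((n : ℝ) ^ 5 * (2 : ℝ) ^ (-(n : ℝ)))) atTop (𝓝 0) := by
  have h := tendsto_pow_const_div_const_pow_of_one_lt 5 (one_lt_two : (1 : ℝ) < 2)
  have h2 := h.const_mul 8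
  rw [mul_zero] at h2
  refine h2.congr fun n => ?_
  rw [Real.rpow_neg two_pos.le, Real.rpow_natCast, div_eq_mul_inv]

/-! ### The two bounds on the clique number. -/

/-- With high probability there are no cliques much larger than `2 ^ d`, provided that
`2 ^ (d + 1)` is larger than `n log n`. -/
theorem eventually_randomSetLaw_real_le_cliqueNum_le {ε δ η : ℝ} (hε : 0 < ε) (hε1 : ε ≤ 1)
    (hδ : 0 < δ) (hη : 0 < η) :
    ∀ᶠ n : ℕ in atTop, ∀ d : ℕ, (1 + δ) * nlog n ≤ 2 * 2 ^ d → 2 * (2 : ℝ) ^ d ≤ 4 * nlog n →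
      (randomSetLaw n).real {A | 2 ^ d + ε * nlog n ≤ ((cayleySumGraph A).cliqueNum : ℝ)} ≤ η := by
  classical
  obtain ⟨K, hK⟩ := exists_card_add_self_le_mul
  obtain ⟨C, hC0, hC⟩ : ∃ C : ℝ, 0 < C ∧ (((2 ^ K ^ 4 * K : ℕ) : ℝ)) * 4 ≤ C :=
    ⟨((2 ^ K ^ 4 * K : ℕ) : ℝ) * 4 + 1, by positivity, by linarith⟩
  -- Bounded doubling will give `2 ^ R ≤ C * L`, so dividing by `C` turns errors proportional to `2
  -- ^ R` into at most `ε * L` in the size of the set and `δ / 2 * L` in the size of the sumset.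
  have hε3 : 0 < min ε (δ / 2) / C := div_pos (lt_min hε (half_pos hδ)) hC0
  obtain ⟨M, hM⟩ := exists_small_subset_large_sumset hε3
  filter_upwards [hK, eventually_mul_add_mul_le hC0 (show 0 < δ / 4 by positivity) M,
    tendsto_logb_natCast.eventually_ge_atTop 64, eventually_ge_atTop 2,
    tendsto_logb_natCast.eventually_ge_atTop (4 / δ),
    tendsto_natCast_atTop_atTop.eventually (eventually_logb_le_mul (show (0 : ℝ) < 1 / 4 by norm_num)),
    tendsto_poly_mul_two_rpow_neg.eventually_lt_const hη]
    with n hK hR hl hn2 hlδ hln hη' d hd1 hd2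
  set L := nlog n with hL
  set l := Real.logb 2 (n : ℝ) with hldef
  have hLl : L = n * l := rfl
  have hn : (2 : ℝ) ≤ n := by exact_mod_cast hn2
  have hL64 : 64 * (n : ℝ) ≤ L := by rw [hLl]; nlinarith
  have hLn : 4 * L ≤ (n : ℝ) ^ 2 := by rw [hLl]; nlinarith
  have hLδ : (n : ℝ) ≤ δ / 4 * L := by
    rw [div_le_iff₀ hδ] at hlδ
    rw [hLl]; nlinarith
  set k := ⌈2 ^ d + ε * L⌉₊ with hk
  have hk1 : 2 ^ d + ε * L ≤ k := Nat.le_ceil _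
  have hL0 : 0 < L := by linarith
  have hk2 : (k : ℝ) < 2 ^ d + ε * L + 1 := Nat.ceil_lt_add_one (by positivity)
  have hkL : L ≤ 2 * (k : ℝ) := by nlinarith
  have hk4 : (k : ℝ) ≤ 4 * L := by nlinarith
  have hkn2 : k ≤ n ^ 2 := by
    have : (k : ℝ) ≤ (n : ℝ) ^ 2 := hk4.trans hLn
    exact_mod_cast this
  have hk32 : 32 * n ≤ k := by
    have : 32 * (n : ℝ) ≤ k := by linarith
    exact_mod_cast this
  let T := ⌈(1 + δ / 2) * L⌉₊
  let E₁ : ℕ → ℕ → Set (Set (F2 n)) := fun R s =>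
    {A | ∃ v : Fin R → F2 n, LinearIndependent (ZMod 2) v ∧
      ∃ Z ∈ (Finset.univ.filter fun X : Finset (F2 R) => X.card = k ∧ (X + X).card = s).image
        (fun X => X + X),
      (((Z.image (Fintype.linearCombination (ZMod 2) v)).erase 0 : Finset (F2 n)) : Set (F2 n)) ⊆ A}
  let E₂ : ℕ → Set (Set (F2 n)) := fun R =>
    {A | ∃ v : Fin R → F2 n, LinearIndependent (ZMod 2) v ∧
      ∃ Z ∈ ((Finset.univ : Finset (Fin (M * 2 ^ (R / 2)) → F2 R)).image
        (fun f => Finset.univ.image f + Finset.univ.image f)).filter (fun Z => T ≤ Z.card),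
      (((Z.image (Fintype.linearCombination (ZMod 2) v)).erase 0 : Finset (F2 n)) : Set (F2 n)) ⊆ A}
  let I₁ : Finset (ℕ × ℕ) := (Finset.Icc 1 n ×ˢ Finset.Icc 1 (n ^ 4)).filter fun p =>
    512 * (n * p.1) ≤ p.2 ∧ 32 * k ≤ p.2
  let I₂ : Finset ℕ := (Finset.Icc 1 n).filter fun R => (2 : ℝ) ^ R ≤ C * L
  have hcover : {A : Set (F2 n) | 2 ^ d + ε * L ≤ ((cayleySumGraph A).cliqueNum : ℝ)} ⊆
      (⋃ p ∈ I₁, E₁ p.1 p.2) ∪ ⋃ R ∈ I₂, E₂ R := by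
    intro A hA
    obtain ⟨X, hXk, hX0, hXA⟩ :=
      exists_sumset_subset_of_le_cliqueNum (k := k) (by omega) (Nat.ceil_le.2 hA)
    obtain ⟨R, v, Y, hRn, hv, hY0, hY1, hYX⟩ := exists_coordinates hX0
    have hinj := linearIndependent_iff_injective_fintypeLinearCombination.1 hv
    have hYk : Y.card = k := by
      rw [← hXk, ← hYX, Finset.card_image_of_injective _ hinj]
    rw [← hYX, ← image_linearCombination_add] at hXA
    have hR1 : 1 ≤ R := by
      by_contra hR0
      obtain rfl : R = 0 := by omega
      have : Y.card ≤ 1 := Finset.card_le_one.2 fun a _ b _ => Subsingleton.elim a b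
      omega
    have hs1 : 1 ≤ (Y + Y).card := Finset.card_pos.2 ⟨0 + 0, Finset.add_mem_add hY0 hY0⟩
    by_cases hcase : 512 * (n * R) ≤ (Y + Y).card ∧ 32 * Y.card ≤ (Y + Y).card
    · refine Or.inl (Set.mem_iUnion₂.2 ⟨(R, (Y + Y).card), ?_, v, hv, Y + Y, ?_, hXA⟩)
      · refine Finset.mem_filter.2 ⟨Finset.mem_product.2 ⟨Finset.mem_Icc.2 ⟨hR1, hRn⟩,
          Finset.mem_Icc.2 ⟨hs1, ?_⟩⟩, hcase.1, hYk ▸ hcase.2⟩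
        calc (Y + Y).card ≤ Y.card * Y.card := Finset.card_add_le
          _ ≤ n ^ 2 * n ^ 2 := by rw [hYk]; gcongr
          _ = n ^ 4 := by ring
      · exact Finset.mem_image_of_mem _ (Finset.mem_filter.2 ⟨Finset.mem_univ _, hYk, rfl⟩)
    · have hdb := hK R Y hY0 hY1 (by rwa [hYk]) (by rwa [hYk]) hcase
      have h2R : (2 : ℝ) ^ R ≤ C * L := by
        have := two_pow_le_of_card_add_self_le hY0 hY1 hdb
        rw [← mul_assoc, hYk] at this
        have h3 : (2 : ℝ) ^ R ≤ ((2 ^ K ^ 4 * K : ℕ) : ℝ) * k := by exact_mod_cast this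
        calc (2 : ℝ) ^ R ≤ ((2 ^ K ^ 4 * K : ℕ) : ℝ) * k := h3
          _ ≤ ((2 ^ K ^ 4 * K : ℕ) : ℝ) * (4 * L) := by gcongr
          _ = ((2 ^ K ^ 4 * K : ℕ) : ℝ) * 4 * L := by ring
          _ ≤ C * L := by gcongr
      have hmin : min ε (δ / 2) / C * 2 ^ R ≤ min ε (δ / 2) * L := by
        calc min ε (δ / 2) / C * 2 ^ R ≤ min ε (δ / 2) / C * (C * L) := by gcongr
          _ = _ := by field_simp
      have hm1 : min ε (δ / 2) * L ≤ ε * L := by gcongr; exact min_le_left _ _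
      have hm2 : min ε (δ / 2) * L ≤ δ / 2 * L := by gcongr; exact min_le_right _ _
      obtain ⟨Z, hZY, hZc, hZZ⟩ := hM R d Y (by rw [hYk]; linarith)
      have hTZ : T ≤ (Z + Z).card := by
        refine Nat.ceil_le.2 ?_
        rw [pow_succ] at hZZ
        linarith
      have hT0 : 0 < T := Nat.ceil_pos.2 (by positivity)
      have hZne : Z.Nonempty := by
        rw [Finset.nonempty_iff_ne_empty]
        rintro rfl
        simp at hTZ
        omega
      obtain ⟨f, hf⟩ := exists_image_fin_eq hZne hZc
      refine Or.inr (Set.mem_iUnion₂.2 ⟨R, Finset.mem_filter.2 ⟨Finset.mem_Icc.2 ⟨hR1, hRn⟩, h2R⟩,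
        v, hv, Z + Z, ?_, fun x hx => hXA ?_⟩)
      · exact Finset.mem_filter.2 ⟨Finset.mem_image.2 ⟨f, Finset.mem_univ _, by rw [hf]⟩, hTZ⟩
      · rw [Finset.mem_coe, Finset.mem_erase] at hx ⊢
        exact ⟨hx.1, Finset.image_subset_image (Finset.add_subset_add hZY hZY) hx.2⟩
  have h1 : (randomSetLaw n).real (⋃ p ∈ I₁, E₁ p.1 p.2) ≤ n ^ 5 * (2 * (2 : ℝ) ^ (-(n : ℝ))) := by
    refine (measureReal_biUnion_finset_le _ _).trans ?_
    refine (Finset.sum_le_card_nsmul _ _ (2 * (2 : ℝ) ^ (-(n : ℝ))) fun p hp => ?_).trans ?_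
    · obtain ⟨hp1, hp2, hp3⟩ := Finset.mem_filter.1 hp
      obtain ⟨hp4, -⟩ := Finset.mem_product.1 hp1
      obtain ⟨hp5, hp6⟩ := Finset.mem_Icc.1 hp4
      refine (randomSetLaw_real_exists_large_sumset_le hp5 hp6 (by omega) hp2 hp3).trans ?_
      have : 2 * n ≤ p.2 := by nlinarith
      have h' : 2 * (n : ℝ) ≤ p.2 := by exact_mod_cast this
      gcongr
      · exact one_le_two
      · linarith
    · rw [nsmul_eq_mul]
      gcongr
      have : I₁.card ≤ n ^ 5 := by
        refine (Finset.card_filter_le _ _).trans ?_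
        rw [Finset.card_product, Nat.card_Icc, Nat.card_Icc]
        simp only [Nat.add_sub_cancel]
        exact le_of_eq (by ring)
      exact_mod_cast this
  have h2 : (randomSetLaw n).real (⋃ R ∈ I₂, E₂ R) ≤ n ^ 5 * (2 * (2 : ℝ) ^ (-(n : ℝ))) := by
    refine (measureReal_biUnion_finset_le _ _).trans ?_
    refine (Finset.sum_le_card_nsmul _ _ (2 * (2 : ℝ) ^ (-(n : ℝ))) fun R hRI => ?_).trans ?_
    · refine randomSetLaw_real_exists_small_le.trans ?_
      -- The exponent is at most `(1 + δ / 4) * L - (1 + δ / 2) * L`, and `δ / 4 * L ≥ n`.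
      have hb := hR R (Finset.mem_filter.1 hRI).2
      have hT : (1 + δ / 2) * L ≤ T := Nat.le_ceil _
      gcongr
      · exact one_le_two
      · linarith
    · rw [nsmul_eq_mul]
      gcongr
      have : I₂.card ≤ n ^ 5 := by
        refine (Finset.card_filter_le _ _).trans ?_
        rw [Nat.card_Icc, Nat.add_sub_cancel]
        exact Nat.le_self_pow (by norm_num) n
      exact_mod_cast this
  refine (measureReal_mono hcover).trans ((measureReal_union_le _ _).trans ?_)
  linarith

/-- With high probability there is a clique of size `2 ^ d`, provided that `2 ^ d` is at most
slightly larger than `n log n`. -/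
theorem eventually_randomSetLaw_real_cliqueNum_lt_le {η : ℝ} (hη : 0 < η) :
    ∀ᶠ n : ℕ in atTop, ∀ d : ℕ, nlog n ≤ 4 * 2 ^ d → (2 : ℝ) ^ d ≤ nlog n + 4 * Real.logb 2 n →
      (randomSetLaw n).real {A | (cayleySumGraph A).cliqueNum < 2 ^ d} ≤ η := by
  obtain ⟨q, hq⟩ := exists_pow_lt_of_lt_one (half_pos hη) (by norm_num : (1 / 2 : ℝ) < 1)
  have hq' : 2 * (1 / 2 : ℝ) ^ (q + 1) ≤ η := by
    rw [pow_succ]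
    linarith
  filter_upwards [tendsto_logb_natCast.eventually_ge_atTop 16,
    tendsto_logb_natCast.eventually_ge_atTop ((q + 1 : ℕ) : ℝ), eventually_ge_atTop 4,
    tendsto_natCast_atTop_atTop.eventually (eventually_logb_le_mul (show (0 : ℝ) < 1 / 4 by norm_num)),
    (Real.tendsto_sqrt_atTop.comp tendsto_natCast_atTop_atTop).eventually
      (eventually_logb_le_mul (show (0 : ℝ) < 1 / 16 by norm_num))]
    with n hl hlq hn4 hln hls d hd1 hd2
  set l := Real.logb 2 (n : ℝ) with hldef
  have hn : (4 : ℝ) ≤ n := by exact_mod_cast hn4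
  have hnpos : (0 : ℝ) < n := by linarith
  have hL : nlog n = n * l := rfl
  rw [hL] at hd1 hd2
  have hl2 : 64 * l ^ 2 ≤ n := by
    have h1 : l = 2 * Real.logb 2 (√(n : ℝ)) := by
      conv_lhs => rw [hldef, ← Real.sq_sqrt hnpos.le]
      rw [Real.logb_pow]
      norm_num
    have h2 : l ≤ 1 / 8 * √(n : ℝ) := by
      simp only [Function.comp] at hls
      linarith
    have h3 := pow_le_pow_left₀ (by linarith) h2 2
    rw [mul_pow, Real.sq_sqrt hnpos.le] at h3
    linarith
  -- As `2 ^ d` is at least `n * l / 4`, the dimension exceeds `log n` by at least `2`. The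
  -- resulting surplus `2 * n` in `d * n` absorbs all the lower-order terms, including the amount by
  -- which `2 ^ d` may exceed `n * l`.
  have hdl : l + 2 ≤ d := by
    have h1 : (2 : ℝ) ^ 2 * n ≤ 2 ^ d := by nlinarith
    have h2 := Real.logb_le_logb_of_le (b := 2) one_lt_two (by positivity) h1
    rw [Real.logb_mul (by norm_num) hnpos.ne', Real.logb_pow, Real.logb_pow,
      Real.logb_self_eq_one one_lt_two] at h2
    push_cast at h2
    linarith
  have hdl2 : (d : ℝ) ≤ 2 * l := by
    have h1 : (2 : ℝ) ^ d ≤ n ^ 2 := by nlinarith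
    have h2 := Real.logb_le_logb_of_le (b := 2) one_lt_two (by positivity) h1
    rw [Real.logb_pow, Real.logb_pow, Real.logb_self_eq_one one_lt_two] at h2
    push_cast at h2
    linarith
  have hdn : 2 * d + (q + 1) ≤ n := by
    have : 2 * (d : ℝ) + ((q + 1 : ℕ) : ℝ) ≤ n := by nlinarith
    exact_mod_cast this
  refine (randomSetLaw_real_cliqueNum_lt_le (Nat.le_add_left 1 q) hdn ?_).trans hq'
  have hc : ((n - 2 * d - (q + 1) : ℕ) : ℝ) = n - 2 * d - ((q + 1 : ℕ) : ℝ) := by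
    rw [Nat.sub_sub, Nat.cast_sub hdn]
    push_cast
    ring
  have hfin : (2 : ℝ) ^ d ≤ d * ((n - 2 * d - (q + 1) : ℕ) : ℝ) := by
    rw [hc]
    have h1 : (n : ℝ) - 5 * l ≤ n - 2 * d - ((q + 1 : ℕ) : ℝ) := by linarith
    have h2 : 0 ≤ (n : ℝ) - 5 * l := by nlinarith
    calc (2 : ℝ) ^ d ≤ n * l + 4 * l := hd2
      _ ≤ (l + 2) * (n - 5 * l) := by nlinarith
      _ ≤ _ := mul_le_mul hdl h1 h2 (by positivity)
  exact_mod_cast hfin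

/-! ### Choice of the subsequences. -/

lemma nlog_nonneg (n : ℕ) : 0 ≤ nlog n := by
  rcases Nat.eq_zero_or_pos n with rfl | hn
  · simp [nlog]
  · exact mul_nonneg n.cast_nonneg (Real.logb_nonneg one_lt_two (by exact_mod_cast hn))

lemma nlog_strictMonoOn {m n : ℕ} (hm : 1 ≤ m) (hmn : m < n) : nlog m < nlog n := by
  have h1 : (1 : ℝ) ≤ m := by exact_mod_cast hm
  have h2 : (m : ℝ) < n := by exact_mod_cast hmn
  have h3 : Real.logb 2 (m : ℝ) < Real.logb 2 n :=
    Real.logb_lt_logb one_lt_two (by linarith) h2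
  have h4 : 0 ≤ Real.logb 2 (m : ℝ) := Real.logb_nonneg one_lt_two h1
  unfold nlog
  nlinarith

lemma tendsto_nlog : Tendsto nlog atTop atTop :=
  tendsto_natCast_atTop_atTop.atTop_mul_atTop₀ tendsto_logb_natCast

/-- Consecutive values of `n log n` differ by little, so suitable `n` come very close to any large
power of two. -/
lemma nlog_succ_le {n : ℕ} (hn : 1 ≤ n) (hl : 2 ≤ Real.logb 2 (n : ℝ)) :
    nlog (n + 1) ≤ nlog n + 4 * Real.logb 2 n := by
  have h1 : (1 : ℝ) ≤ n := by exact_mod_cast hn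
  have h5 : Real.logb 2 ((n : ℝ) + 1) ≤ Real.logb 2 n + 2 / n := by
    have h6 : (n : ℝ) + 1 = n * (1 + 1 / n) := by field_simp
    have hpos : (0 : ℝ) < 1 + 1 / n := by positivity
    rw [h6, Real.logb_mul (by positivity) hpos.ne']
    have h7 : Real.log (1 + 1 / (n : ℝ)) ≤ 1 / n := by
      linarith [Real.log_le_sub_one_of_pos hpos]
    have h8 : 1 / 2 < Real.log 2 := by linarith [Real.log_two_gt_d9]
    have h9 : Real.logb 2 (1 + 1 / (n : ℝ)) ≤ 2 / n := by
      rw [Real.logb, div_le_iff₀ (by linarith)]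
      refine h7.trans ?_
      have : 0 < 1 / (n : ℝ) := by positivity
      calc 1 / (n : ℝ) = 1 / n * 1 := by ring
        _ ≤ 1 / n * (2 * Real.log 2) := by gcongr; linarith
        _ = _ := by ring
    linarith
  have h10 : 2 / (n : ℝ) ≤ 2 := by rw [div_le_iff₀ (by linarith)]; linarith
  unfold nlog
  push_cast
  calc ((n : ℝ) + 1) * Real.logb 2 (n + 1) ≤ (n + 1) * (Real.logb 2 n + 2 / n) := by gcongr
    _ = n * Real.logb 2 n + Real.logb 2 n + 2 + 2 / n := by field_simp; ring
    _ ≤ _ := by linarith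

/-- Beyond any given point there is an index just before `n log n` crosses a power of two. -/
lemma exists_nlog_lt_two_pow_le {c : ℝ} (hc : 0 < c) (N : ℕ) :
    ∃ n d : ℕ, N ≤ n ∧ c * nlog n < 2 ^ d ∧ (2 : ℝ) ^ d ≤ c * nlog (n + 1) := by
  have ht : Tendsto (fun n => c * nlog n) atTop atTop := tendsto_nlog.const_mul_atTop hc
  obtain ⟨d, hd⟩ := pow_unbounded_of_one_lt (c * nlog (N + 1)) (one_lt_two : (1 : ℝ) < 2)
  classical
  have hex : ∃ m, (2 : ℝ) ^ d ≤ c * nlog m := (ht.eventually_ge_atTop _).exists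
  have hmin := fun m => Nat.find_min hex (m := m)
  have hspec := Nat.find_spec hex
  set m := Nat.find hex
  have hNm : N + 1 < m := by
    by_contra h
    have hm0 : m ≠ 0 := by
      intro h0
      rw [h0, nlog, Nat.cast_zero, zero_mul, mul_zero] at hspec
      exact absurd hspec (not_le.2 (by positivity))
    have : nlog m ≤ nlog (N + 1) := by
      rcases (not_lt.1 h).eq_or_lt with h | h
      · rw [h]
      · exact (nlog_strictMonoOn (by omega) h).le
    nlinarith
  obtain ⟨n, hn⟩ : ∃ n, m = n + 1 := ⟨m - 1, by omega⟩
  exact ⟨n, d, by omega, not_le.1 (hmin n (by omega)), hn ▸ hspec⟩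

lemma one_sub_le_probCliqueNumBetween {n d : ℕ} {lo hi u a b : ℝ} (hlo : lo < 2 ^ d) (hu : u ≤ hi)
    (ha : (randomSetLaw n).real {A | (cayleySumGraph A).cliqueNum < 2 ^ d} ≤ a)
    (hb : (randomSetLaw n).real {A | u ≤ ((cayleySumGraph A).cliqueNum : ℝ)} ≤ b) :
    1 - (a + b) ≤ probCliqueNumBetween n lo hi := by
  have hcover : (Set.univ : Set (Set (F2 n))) ⊆
      {A | lo < ((cayleySumGraph A).cliqueNum : ℝ) ∧ ((cayleySumGraph A).cliqueNum : ℝ) < hi} ∪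
      ({A | (cayleySumGraph A).cliqueNum < 2 ^ d} ∪
        {A | u ≤ ((cayleySumGraph A).cliqueNum : ℝ)}) := by
    intro A _
    by_cases h1 : (cayleySumGraph A).cliqueNum < 2 ^ d
    · exact Or.inr (Or.inl h1)
    by_cases h2 : u ≤ ((cayleySumGraph A).cliqueNum : ℝ)
    · exact Or.inr (Or.inr h2)
    have h3 : (2 : ℝ) ^ d ≤ (cayleySumGraph A).cliqueNum := by exact_mod_cast not_lt.1 h1
    exact Or.inl ⟨hlo.trans_le h3, (not_le.1 h2).trans_le hu⟩
  have h := (measureReal_mono (μ := randomSetLaw n) hcover).trans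
    ((measureReal_union_le _ _).trans (add_le_add_right (measureReal_union_le _ _) _))
  rw [probReal_univ] at h
  unfold probCliqueNumBetween
  linarith

/-- Take `2^(d+1)` just above `(1 + ε / 4) n log n`. The factor `1 + ε / 4` is the room the upper
bound requires, and it leaves `2^d` within about `(ε / 8) n log n` of half of `n log n`. -/
lemma exists_one_sub_le_prob_half {ε : ℝ} (hε : 0 < ε) (hε1 : ε ≤ 1) (N : ℕ) :
    ∃ n ≥ N, 1 - ε ≤
      probCliqueNumBetween n (1 / 2 * nlog n) ((1 / 2 + ε) * nlog n) := by
  have hup := eventually_randomSetLaw_real_le_cliqueNum_le (ε := ε / 4) (δ := ε / 4) (η := ε / 2)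
    (by positivity) (by linarith) (by positivity) (by positivity)
  have hlow := eventually_randomSetLaw_real_cliqueNum_lt_le (η := ε / 2) (by positivity)
  obtain ⟨N', hN'⟩ := eventually_atTop.1 (hup.and (hlow.and
    ((tendsto_logb_natCast.eventually_ge_atTop 2).and
    ((eventually_ge_atTop 1).and (tendsto_natCast_atTop_atTop.eventually_ge_atTop (32 / ε))))))
  obtain ⟨n, D, hn, h1, h2⟩ := exists_nlog_lt_two_pow_le (c := 1 + ε / 4) (by positivity)
    (max N N')
  obtain ⟨hu, hl, hl2, hn1, hnε⟩ := hN' n ((le_max_right _ _).trans hn)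
  have hs := nlog_succ_le hn1 hl2
  have hL : nlog n = n * Real.logb 2 n := rfl
  have hn1' : (1 : ℝ) ≤ n := by exact_mod_cast hn1
  rw [div_le_iff₀ hε] at hnε
  have hsmall : 4 * Real.logb 2 (n : ℝ) ≤ ε / 8 * nlog n := by rw [hL]; nlinarith
  have hLpos : 2 ≤ nlog n := by rw [hL]; nlinarith
  have hD : 1 ≤ D := by
    by_contra h
    obtain rfl : D = 0 := by omega
    simp only [pow_zero] at h1
    nlinarith
  obtain ⟨d, rfl⟩ : ∃ d, D = d + 1 := ⟨D - 1, by omega⟩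
  rw [pow_succ, mul_comm _ (2 : ℝ)] at h1 h2
  have h3 : 2 * (2 : ℝ) ^ d ≤ (1 + ε / 4) * ((1 + ε / 8) * nlog n) :=
    h2.trans (by gcongr; linarith)
  have h4 : 2 * (2 : ℝ) ^ d ≤ (1 + ε / 2) * nlog n := by
    refine h3.trans ?_
    rw [← mul_assoc]
    gcongr
    nlinarith
  have h5 : ε * nlog n ≤ nlog n := by nlinarith
  refine ⟨n, (le_max_left _ _).trans hn, ?_⟩
  have := one_sub_le_probCliqueNumBetween (n := n) (d := d) (lo := 1 / 2 * nlog n)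
    (hi := (1 / 2 + ε) * nlog n) (by nlinarith) (by nlinarith) (hl d (by nlinarith) (by nlinarith))
    (hu d h1.le (by nlinarith))
  linarith

/-- Take `2^d` just above `n log n`, where cliques of size `2^d` are still likely. As `2^(d+1) > 2 n
log n`, the upper bound applies with room to spare. -/
lemma exists_one_sub_le_prob_one {ε : ℝ} (hε : 0 < ε) (hε1 : ε ≤ 1) (N : ℕ) :
    ∃ n ≥ N, 1 - ε ≤ probCliqueNumBetween n (nlog n) ((1 + ε) * nlog n) := by
  have hup := eventually_randomSetLaw_real_le_cliqueNum_le (ε := ε / 2) (δ := 1 / 2) (η := ε / 2)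
    (by positivity) (by linarith) (by positivity) (by positivity)
  have hlow := eventually_randomSetLaw_real_cliqueNum_lt_le (η := ε / 2) (by positivity)
  obtain ⟨N', hN'⟩ := eventually_atTop.1 (hup.and (hlow.and
    ((tendsto_logb_natCast.eventually_ge_atTop 2).and
    ((eventually_ge_atTop 1).and (tendsto_natCast_atTop_atTop.eventually_ge_atTop (32 / ε))))))
  obtain ⟨n, d, hn, h1, h2⟩ := exists_nlog_lt_two_pow_le one_pos (max N N')
  obtain ⟨hu, hl, hl2, hn1, hnε⟩ := hN' n ((le_max_right _ _).trans hn)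
  rw [one_mul] at h1 h2
  have hs := nlog_succ_le hn1 hl2
  have hL : nlog n = n * Real.logb 2 n := rfl
  have hn1' : (1 : ℝ) ≤ n := by exact_mod_cast hn1
  rw [div_le_iff₀ hε] at hnε
  have hsmall : 4 * Real.logb 2 (n : ℝ) ≤ ε / 8 * nlog n := by rw [hL]; nlinarith
  have hLpos : 2 ≤ nlog n := by rw [hL]; nlinarith
  have h5 : ε * nlog n ≤ nlog n := by nlinarith
  refine ⟨n, (le_max_left _ _).trans hn, ?_⟩
  have := one_sub_le_probCliqueNumBetween (n := n) (d := d) (lo := nlog n)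
    (hi := (1 + ε) * nlog n) h1 (by nlinarith) (hl d (by linarith) (by linarith))
    (hu d (by linarith) (by linarith))
  linarith

lemma probCliqueNumBetween_le_one (n : ℕ) (lo hi : ℝ) : probCliqueNumBetween n lo hi ≤ 1 :=
  measureReal_le_one

lemma probCliqueNumBetween_mono {n : ℕ} {lo hi hi' : ℝ} (h : hi ≤ hi') :
    probCliqueNumBetween n lo hi ≤ probCliqueNumBetween n lo hi' :=
  measureReal_mono fun _ hA => ⟨hA.1, hA.2.trans_le h⟩

/-- Diagonal choice with `ε = 1 / (i + 1)` at the `i`-th index. One sequence serves every `ε`, since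
raising the upper end of the interval only raises the probability. -/
lemma exists_strictMono_tendsto_prob {c : ℝ}
    (h : ∀ ε : ℝ, 0 < ε → ε ≤ 1 → ∀ N : ℕ, ∃ n ≥ N,
      1 - ε ≤ probCliqueNumBetween n (c * nlog n) ((c + ε) * nlog n)) :
    ∃ n : ℕ → ℕ, StrictMono n ∧ ∀ ε : ℝ, 0 < ε →
      Tendsto (fun i => probCliqueNumBetween (n i) (c * nlog (n i)) ((c + ε) * nlog (n i)))
        atTop (𝓝 1) := by
  obtain ⟨n, hn, hprob⟩ := extraction_forall_of_frequently
    (P := fun i n => 1 - 1 / ((i : ℝ) + 1) ≤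
      probCliqueNumBetween n (c * nlog n) ((c + 1 / ((i : ℝ) + 1)) * nlog n))
    fun i => frequently_atTop.2 <| h _ Nat.one_div_pos_of_nat (by
      rw [div_le_one (by positivity)]; linarith [(Nat.cast_nonneg i : (0 : ℝ) ≤ i)])
  have hlim := tendsto_one_div_add_atTop_nhds_zero_nat (𝕜 := ℝ)
  refine ⟨n, hn, fun ε hε => ?_⟩
  have hlow : Tendsto (fun i : ℕ => 1 - 1 / ((i : ℝ) + 1)) atTop (𝓝 1) := by
    simpa using hlim.const_sub 1
  refine tendsto_of_tendsto_of_tendsto_of_le_of_le' hlow tendsto_const_nhds ?_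
    (Eventually.of_forall fun i => probCliqueNumBetween_le_one _ _ _)
  filter_upwards [hlim.eventually_le_const hε] with i hi
  refine (hprob i).trans (probCliqueNumBetween_mono ?_)
  have := nlog_nonneg (n i)
  gcongr

theorem theorem2 :
    (∃ n : ℕ → ℕ, StrictMono n ∧ ∀ ε : ℝ, 0 < ε →
      Tendsto (fun i => probCliqueNumBetween (n i) (1 / 2 * nlog (n i)) ((1 / 2 + ε) * nlog (n i)))
        atTop (𝓝 1)) ∧
    (∃ n : ℕ → ℕ, StrictMono n ∧ ∀ ε : ℝ, 0 < ε →
      Tendsto (fun j => probCliqueNumBetween (n j) (nlog (n j)) ((1 + ε) * nlog (n j)))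
        atTop (𝓝 1)) := by
  refine ⟨exists_strictMono_tendsto_prob fun ε h0 h1 N => exists_one_sub_le_prob_half h0 h1 N, ?_⟩
  simpa only [one_mul] using exists_strictMono_tendsto_prob (c := 1) fun ε h0 h1 N => by
    simpa only [one_mul] using exists_one_sub_le_prob_one h0 h1 N
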